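/- Conventions. Order $\mathbb{R}^m$ coordinatewise, let the rank of a point be the sum of its coordinates, $\operatorname{rk}(x)=\sum_i x_i$, and let the rank of a compact (or finite) nonempty set be the sum of the maximum and the minimum rank of its points. A polytope $P$ of dimension $m$ in $\mathbb{R}^m$ is a finite nonempty union of full-dimensional convex polytopes (it need not be convex), and $P(k)=P\cap\frac1k\mathbb{Z}^m$. A *partial simplex* is a simplex from which some relatively open faces, other than its relative interior, are removed. A *swipe* in a coordinate direction $e_i$ is given by partial simplices $S^s,S^e$ (its starting and ending turning sets) such that translation by non-negative multiples of $e_i$ gives a bijection of $S^s$ with $S^e$ ($e_i$ not being parallel to $S^s$); the swipe $S$ is the union of the segments in direction $e_i$ connecting $S^s$ and $S^e$. A sequence of swipes $S_0,\dots,S_r$ is *compatible* if $S_i^e=S_{i+1}^s$ for $0\le i<r$. It forms a *real snake* $\bigcup_i S_i$ if, whenever $i<j$ and $x\in S_i\cap S_j$, then $x\in S_i^e$, $x\in S_j^s$, and $x\in S_l^s\cap S_l^e$ for all $i<l<j$. A point $x\in S_i$ is *$i$-halted* if either $x\in S_i^s$ and $x\in S_l^s\cap S_l^e$ for all $l<i$,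 or $x\in S_i^e$ and $x\in S_l^s\cap S_l^e$ for all $l>i$. With $T_i=S_i\setminus\{i\text{-halted points}\}$, the sequence forms a *fake snake* $\bigcup_i T_i$ if, whenever $i<j$ and $x\in T_i\cap T_j$, then $x\in S_i^e$, $x\in S_j^s$, and $x\in T_l\cap S_l^s\cap S_l^e$ for all $i<l<j$. A snake (real or fake) is *symmetric* in $P$ if for every vertex of $\overline{S_0^s}$ and the corresponding vertex of $\overline{S_r^e}$ the sum of their ranks is the rank of $P$. An *asymptotic geometric symmetric chain decomposition* of $P$ is a finite collection of pairwise disjoint symmetric snakes contained in $P$, each of dimension $m$, such that the set of points of $P$ in no snake has codimension $\ge1$ (is covered by finitely many proper affine subspaces). It satisfies the *weak hyperplane condition* if for each snake and each $0\le l<r$, where $S_l$ and $S_{l+1}$ have directions $e_i$ and $e_j$, the turning set $S_l^e=S_{l+1}^s$ lies in a hyperplane $\sum_n a_nx_n=b$ with $a_i=a_j$. A *symmetric chain* in $P(k)$ is a sequence $x_0\le x_1\le\dots\le x_n$ in $P(k)$ with $\operatorname{rk}(x_{j+1})=\operatorname{rk}(x_j)+\frac1k$ for $0\le j<n$ and with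 $\operatorname{rk}(x_0)+\operatorname{rk}(x_n)$ equal to the rank of $P(k)$. **Theorem.** Let $P$ be a polytope of dimension $m$ in $\mathbb{R}^m$ with an asymptotic geometric symmetric chain decomposition satisfying the weak hyperplane condition. Then there is a constant $C$ such that for every integer $k\ge1$ one can delete at most $\frac{C}{k}\,|P(k)|$ points from $P(k)$ so that the set of remaining points can be partitioned into symmetric chains of $P(k)$. -/

import Mathlib

/-- The rank of a point of `ℝ^m`: the sum of its coordinates. -/
def rk {m : ℕ} (x : Fin m → ℝ) : ℝ := ∑ i, x i

/-- The rank of a set of points: the sum of the maximum and the minimum rank of its points. It is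
used for polytopes (compact) and for the finite posets `P(k)`, where both extrema are attained. -/
noncomputable def setRank {m : ℕ} (A : Set (Fin m → ℝ)) : ℝ := sSup (rk '' A) + sInf (rk '' A)

/-- Polytopes of dimension `m` in `ℝ^m`, not necessarily convex: finite nonempty unions of
full-dimensional convex polytopes. -/
def IsFullDimPolytope {m : ℕ} (P : Set (Fin m → ℝ)) : Prop :=
  ∃ 𝒱 : Finset (Finset (Fin m → ℝ)), 𝒱.Nonempty ∧
    (∀ V ∈ 𝒱, (interior (convexHull ℝ (V : Set (Fin m → ℝ)))).Nonempty) ∧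
    P = ⋃ V ∈ 𝒱, convexHull ℝ (V : Set (Fin m → ℝ))

/-- The poset `P(k) = P ∩ (1/k)ℤ^m`, ordered coordinatewise. -/
def latticePoints {m : ℕ} (P : Set (Fin m → ℝ)) (k : ℕ) : Set (Fin m → ℝ) :=
  {x | x ∈ P ∧ ∀ i, ∃ z : ℤ, (k : ℝ) * x i = z}

/-- The open sub-simplex spanned by the vertices `v a`, `a ∈ F` (the relative interior of their
convex hull when `v` is affinely independent): the points whose barycentric coordinates are
positive on `F` and zero off `F`. -/
def openFace {m d : ℕ} (v : Fin (d + 1) → Fin m → ℝ) (F : Finset (Fin (d + 1))) :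
    Set (Fin m → ℝ) :=
  {x | ∃ w : Fin (d + 1) → ℝ, (∀ a ∈ F, 0 < w a) ∧ (∀ a ∉ F, w a = 0) ∧ ∑ a, w a = 1 ∧
    x = ∑ a, w a • v a}

/-- The simplex with vertices `v` with the open sub-simplices listed in `R` removed. -/
def partialSimplex {m d : ℕ} (v : Fin (d + 1) → Fin m → ℝ) (R : Set (Finset (Fin (d + 1)))) :
    Set (Fin m → ℝ) :=
  convexHull ℝ (Set.range v) \ ⋃ F ∈ R, openFace v F

/-- A compatible sequence of swipes `S_0, …, S_last` in `ℝ^m`. The turning sets are numbered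
`0, …, last + 1`; the swipe `S_i` starts at turning set `i` and ends at turning set `i + 1`, which
is also where `S_{i+1}` starts. Turning set `j` is the partial simplex with vertices `vertex j` and
removed open faces `removed`. Vertices with the same label correspond to each other under
translation in the direction of the swipe; the translation matches faces with faces, so the
labels of the removed faces do not depend on `j`. -/
structure SwipeSeq (m : ℕ) where
  /-- dimension of the turning sets -/
  d : ℕ
  /-- index of the last swipe -/
  last : ℕ
  /-- the coordinate direction of each swipe -/
  dir : Fin (last + 1) → Fin m
  /-- the vertices of (the closures of) the turning sets -/
  vertex : Fin (last + 1 + 1) → Fin (d + 1) → Fin m → ℝ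
  /-- the open faces removed from the turning simplices -/
  removed : Set (Finset (Fin (d + 1)))
  /-- the relative interior of the whole simplex is not removed -/
  univ_notMem : Finset.univ ∉ removed
  /-- the turning sets are nondegenerate simplices -/
  indep : ∀ j, AffineIndependent ℝ (vertex j)
  /-- start vertices are moved to end vertices by non-negative multiples of the direction -/
  translate : ∀ i a, ∃ t : ℝ, 0 ≤ t ∧
    vertex i.succ a = vertex i.castSucc a + t • Pi.single (dir i) (1 : ℝ)
  /-- the direction is not parallel to the starting set, so that every line in this direction
  meets the starting set at most once and translation does define a bijection between the
  starting and the ending set -/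
  transversal : ∀ i, Pi.single (dir i) (1 : ℝ) ∉ vectorSpan ℝ (Set.range (vertex i.castSucc))

namespace SwipeSeq

variable {m : ℕ} (S : SwipeSeq m)

/-- The turning sets. -/
def turningSet (j : Fin (S.last + 1 + 1)) : Set (Fin m → ℝ) :=
  partialSimplex (S.vertex j) S.removed

/-- The starting turning set of the `i`-th swipe. -/
def startSet (i : Fin (S.last + 1)) : Set (Fin m → ℝ) := S.turningSet i.castSucc

/-- The ending turning set of the `i`-th swipe. -/
def endSet (i : Fin (S.last + 1)) : Set (Fin m → ℝ) := S.turningSet i.succ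

/-- The `i`-th swipe: the union of all line segments in its direction that connect its starting
set to its ending set. -/
def swipe (i : Fin (S.last + 1)) : Set (Fin m → ℝ) :=
  {z | ∃ x ∈ S.startSet i, ∃ y ∈ S.endSet i,
    (∃ t : ℝ, 0 ≤ t ∧ y = x + t • Pi.single (S.dir i) (1 : ℝ)) ∧ z ∈ segment ℝ x y}

/-- The union of the swipes. -/
def realSet : Set (Fin m → ℝ) := ⋃ i, S.swipe i

/-- The sequence of swipes forms a real snake (non self-intersection). -/
def IsReal : Prop :=
  ∀ i j, i < j → ∀ x, x ∈ S.swipe i → x ∈ S.swipe j →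
    x ∈ S.endSet i ∧ x ∈ S.startSet j ∧
      ∀ l, i < l → l < j → x ∈ S.startSet l ∧ x ∈ S.endSet l

/-- `x` is an `i`-halted point (used for points `x` of the `i`-th swipe). -/
def Halted (i : Fin (S.last + 1)) (x : Fin m → ℝ) : Prop :=
  ((∀ l, l < i → x ∈ S.startSet l ∧ x ∈ S.endSet l) ∧ x ∈ S.startSet i) ∨
  ((∀ l, i < l → x ∈ S.startSet l ∧ x ∈ S.endSet l) ∧ x ∈ S.endSet i)

/-- The `i`-th swipe without its `i`-halted points. -/
def fakeSwipe (i : Fin (S.last + 1)) : Set (Fin m → ℝ) := {x | x ∈ S.swipe i ∧ ¬ S.Halted i x}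

/-- The union of the swipes without their halted points. -/
def fakeSet : Set (Fin m → ℝ) := ⋃ i, S.fakeSwipe i

/-- The sequence of swipes forms a fake snake (non self-intersection). -/
def IsFake : Prop :=
  ∀ i j, i < j → ∀ x, x ∈ S.fakeSwipe i → x ∈ S.fakeSwipe j →
    x ∈ S.endSet i ∧ x ∈ S.startSet j ∧
      ∀ l, i < l → l < j → x ∈ S.fakeSwipe l ∧ x ∈ S.startSet l ∧ x ∈ S.endSet l

/-- `X` is the snake, real or fake, formed by the sequence of swipes. -/
def IsSnake (X : Set (Fin m → ℝ)) : Prop :=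
  (S.IsReal ∧ X = S.realSet) ∨ (S.IsFake ∧ X = S.fakeSet)

/-- Corresponding vertices of the first starting set and of the last ending set have ranks which
sum to the rank of `P`. -/
def IsSymmetric (P : Set (Fin m → ℝ)) : Prop :=
  ∀ a, rk (S.vertex 0 a) + rk (S.vertex (Fin.last (S.last + 1)) a) = setRank P

/-- Every turning set between two swipes, of directions `e_i` and `e_j`, lies in a hyperplane
`∑ a_l x_l = b` with `a_i = a_j`. -/
def WeakHyperplane : Prop :=
  ∀ i : Fin S.last, ∃ (a : Fin m → ℝ) (b : ℝ), a ≠ 0 ∧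
    (∀ x ∈ S.endSet i.castSucc, ∑ l, a l * x l = b) ∧
    a (S.dir i.castSucc) = a (S.dir i.succ)

end SwipeSeq

/-- A (polyhedral) subset of `ℝ^m` has codimension at least one: it is covered by finitely many
proper affine subspaces. -/
def CodimAtLeastOne {m : ℕ} (A : Set (Fin m → ℝ)) : Prop :=
  ∃ 𝓗 : Set (AffineSubspace ℝ (Fin m → ℝ)), 𝓗.Finite ∧ (∀ H ∈ 𝓗, H ≠ ⊤) ∧
    A ⊆ ⋃ H ∈ 𝓗, (H : Set (Fin m → ℝ))

/-- An asymptotic geometric symmetric chain decomposition of `P`: a finite disjoint collection of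
symmetric snakes of dimension `m` inside `P` which cover `P` up to codimension one. -/
structure AsymptoticGSCD {m : ℕ} (P : Set (Fin m → ℝ)) where
  /-- the number of snakes -/
  size : ℕ
  /-- the sequences of swipes forming the snakes -/
  seq : Fin size → SwipeSeq m
  /-- the snakes -/
  snake : Fin size → Set (Fin m → ℝ)
  isSnake : ∀ s, (seq s).IsSnake (snake s)
  subset : ∀ s, snake s ⊆ P
  fullDim : ∀ s, (interior (snake s)).Nonempty
  symmetric : ∀ s, (seq s).IsSymmetric P
  disjoint : ∀ s t, s ≠ t → Disjoint (snake s) (snake t)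
  codim : CodimAtLeastOne (P \ ⋃ s, snake s)

/-- The weak hyperplane condition. -/
def AsymptoticGSCD.WeakHyperplane {m : ℕ} {P : Set (Fin m → ℝ)} (𝒟 : AsymptoticGSCD P) : Prop :=
  ∀ s, (𝒟.seq s).WeakHyperplane

/-- `c` is a symmetric chain in the poset `Q = P(k)`: an increasing sequence of points of `Q` whose
ranks go up by exactly `1/k` in each step (no rank is skipped), and whose smallest and largest
rank sum to the minimum rank plus the maximum rank of `Q`. -/
def IsSymmetricChain {m : ℕ} (Q : Set (Fin m → ℝ)) (k : ℕ) (c : Set (Fin m → ℝ)) : Prop :=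
  ∃ (n : ℕ) (x : Fin (n + 1) → Fin m → ℝ),
    (∀ j, x j ∈ Q) ∧
    (∀ j : Fin n, x j.castSucc ≤ x j.succ ∧ rk (x j.succ) = rk (x j.castSucc) + 1 / (k : ℝ)) ∧
    rk (x 0) + rk (x (Fin.last n)) = setRank Q ∧
    c = Set.range x

/-- The subset `A` of the poset `Q = P(k)` can be partitioned into symmetric chains of `Q`. -/
def DecomposesIntoSymmetricChains {m : ℕ} (Q : Set (Fin m → ℝ)) (k : ℕ)
    (A : Set (Fin m → ℝ)) : Prop :=
  ∃ 𝒞 : Set (Set (Fin m → ℝ)), (∀ c ∈ 𝒞, IsSymmetricChain Q k c) ∧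
    𝒞.PairwiseDisjoint id ∧ ⋃₀ 𝒞 = A

/-! A lattice path is run along every snake in the directions of its swipes, and the weak hyperplane
condition keeps these paths disjoint. If a turning set lies in a hyperplane with equal coefficients
for the incoming direction `e_i` and the outgoing direction `e_j`, these coefficients are nonzero,
and the signed height above the hyperplane is the same whether measured along `e_i` or along `e_j`
(`SwipeSeq.he_eq_hs`). Every lattice line in either direction therefore has exactly one lattice
point with height in `(-1/k, 0]`. A path turns at that point, so incoming and outgoing lines are
matched bijectively, and each lattice point on a swipe determines a unique path
(`Track.exists_turning_through`, `Track.IsTurning.ext`).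

At each turn the barycentric coordinates change by `O(1/k)` (`Track.exists_drift`). Hence a path
through a point at distance at least a suitable multiple of `1/k` from the side walls stays in the
interior of the simplices, and the ranks of its ends sum to the rank of `P` up to `O(1/k)`
(`Track.exists_rk_add_rk`). The rank of `P(k)` differs from that of `P` by `O(1/k)` as well.
Trimming a bounded number of points at the ends gives exactly symmetric chains
(`Track.isSymmetricChain_chain`). The trimming also removes the end points at which halting in a
fake snake could matter, so real and fake snakes obey the same axioms (`Track.Carries`).

The points lost lie within `O(1/k)` of finitely many hyperplanes, or in the codimension-one
remainder of `P`. There are `O(k^(m-1))` of them (`negligible_strip`), while `P(k)` has at least a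
constant times `k^m` points for large `k`. -/

open Set

/-! ### Counting lattice points near hyperplanes -/

/-- The sets `E k` contain only `O(k ^ (m - 1))` points of `P(k)`. -/
def Negligible {m : ℕ} (P : Set (Fin m → ℝ)) (E : ℕ → Set (Fin m → ℝ)) : Prop :=
  ∃ C : ℝ, ∀ k : ℕ, 1 ≤ k → ((E k ∩ latticePoints P k).ncard : ℝ) * k ≤ C * (k : ℝ) ^ m

theorem latticePoints_floor {m : ℕ} {P : Set (Fin m → ℝ)} {k : ℕ} {x : Fin m → ℝ}
    (hx : x ∈ latticePoints P k) (i : Fin m) : ((⌊(k : ℝ) * x i⌋ : ℤ) : ℝ) = k * x i := by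
  obtain ⟨z, hz⟩ := hx.2 i
  rw [hz, Int.floor_intCast]

theorem finite_latticePoints {m : ℕ} {P : Set (Fin m → ℝ)} {B : ℕ}
    (hB : ∀ x ∈ P, ∀ i, |x i| ≤ B) {k : ℕ} (hk : 1 ≤ k) : (latticePoints P k).Finite := by
  have hk0 : (0 : ℝ) < k := by exact_mod_cast hk
  refine Set.Finite.of_finite_image (f := fun x i => ⌊(k : ℝ) * x i⌋) ?_ ?_
  · refine (Fintype.piFinset
      (fun _ : Fin m => Finset.Icc (-(B * k : ℤ)) (B * k))).finite_toSet.subset ?_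
    rintro _ ⟨x, hx, rfl⟩
    simp only [Finset.mem_coe, Fintype.mem_piFinset, Finset.mem_Icc]
    intro i
    have h := abs_le.1 (hB x hx.1 i)
    have e := latticePoints_floor hx i
    constructor
    · have : (-(B * k : ℤ) : ℝ) ≤ (⌊(k : ℝ) * x i⌋ : ℤ) := by rw [e]; push_cast; nlinarith
      exact_mod_cast this
    · have : ((⌊(k : ℝ) * x i⌋ : ℤ) : ℝ) ≤ ((B * k : ℤ) : ℝ) := by rw [e]; push_cast; nlinarith
      exact_mod_cast this
  · intro x hx y hy hxy
    ext i
    have h := congrFun hxy i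
    simp only at h
    have h2 : (k : ℝ) * x i = k * y i := by
      rw [← latticePoints_floor hx i, ← latticePoints_floor hy i, h]
    exact mul_left_cancel₀ hk0.ne' h2

theorem Negligible.mono {m : ℕ} {P : Set (Fin m → ℝ)} {B : ℕ} (hB : ∀ x ∈ P, ∀ i, |x i| ≤ B)
    {E F : ℕ → Set (Fin m → ℝ)} (hE : Negligible P E)
    (h : ∀ k, 1 ≤ k → F k ∩ latticePoints P k ⊆ E k) : Negligible P F := by
  obtain ⟨C, hC⟩ := hE
  refine ⟨C, fun k hk => le_trans ?_ (hC k hk)⟩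
  gcongr ?_ * _
  exact_mod_cast ncard_le_ncard (subset_inter (h k hk) inter_subset_right)
    ((finite_latticePoints hB hk).subset inter_subset_right)

theorem negligible_empty {m : ℕ} (P : Set (Fin m → ℝ)) : Negligible P (fun _ => ∅) :=
  ⟨0, fun k _ => by simp⟩

theorem negligible_of_eventually {m : ℕ} {P : Set (Fin m → ℝ)} {E : ℕ → Set (Fin m → ℝ)} (K₀ : ℕ)
    (h : ∀ k ≥ K₀, E k = ∅) : Negligible P E := by
  -- The finitely many exceptional `k` are absorbed into the constant, since `k ^ m ≥ 1`.
  refine ⟨∑ k ∈ Finset.range K₀, ((E k ∩ latticePoints P k).ncard : ℝ) * k, fun k hk => ?_⟩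
  have hk1 : (1 : ℝ) ≤ (k : ℝ) ^ m := one_le_pow₀ (by exact_mod_cast hk)
  have h0 : 0 ≤ ∑ k ∈ Finset.range K₀, ((E k ∩ latticePoints P k).ncard : ℝ) * k :=
    Finset.sum_nonneg fun _ _ => by positivity
  rcases lt_or_ge k K₀ with hlt | hge
  · refine le_trans ?_ (le_mul_of_one_le_right h0 hk1)
    exact Finset.single_le_sum (f := fun k => ((E k ∩ latticePoints P k).ncard : ℝ) * k)
      (fun _ _ => by positivity) (Finset.mem_range.2 hlt)
  · rw [h k hge]
    simp only [empty_inter, ncard_empty, Nat.cast_zero, zero_mul]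
    positivity

theorem Negligible.union {m : ℕ} {P : Set (Fin m → ℝ)} {E F : ℕ → Set (Fin m → ℝ)}
    (hE : Negligible P E) (hF : Negligible P F) : Negligible P (fun k => E k ∪ F k) := by
  obtain ⟨C, hC⟩ := hE
  obtain ⟨C', hC'⟩ := hF
  refine ⟨C + C', fun k hk => ?_⟩
  have h1 := hC k hk
  have h2 := hC' k hk
  have h3 : (((E k ∪ F k) ∩ latticePoints P k).ncard : ℝ) ≤
      (E k ∩ latticePoints P k).ncard + (F k ∩ latticePoints P k).ncard := by
    rw [union_inter_distrib_right]
    exact_mod_cast ncard_union_le _ _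
  have hk0 : (0 : ℝ) ≤ k := by positivity
  nlinarith

theorem Negligible.biUnion {m : ℕ} {P : Set (Fin m → ℝ)} {ι : Type*} {s : Set ι} (hs : s.Finite)
    {E : ι → ℕ → Set (Fin m → ℝ)} (h : ∀ i ∈ s, Negligible P (E i)) :
    Negligible P (fun k => ⋃ i ∈ s, E i k) := by
  induction s, hs using Set.Finite.induction_on with
  | empty => simpa using negligible_empty P
  | @insert a s _ _ ih =>
    simp only [biUnion_insert]
    exact (h a (mem_insert a s)).union (ih fun i hi => h i (mem_insert_of_mem a hi))

theorem Negligible.iUnion {m : ℕ} {P : Set (Fin m → ℝ)} {ι : Type*} [Finite ι]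
    {E : ι → ℕ → Set (Fin m → ℝ)} (h : ∀ i, Negligible P (E i)) :
    Negligible P (fun k => ⋃ i, E i k) := by
  simpa using Negligible.biUnion (finite_univ (α := ι)) (E := E) (fun i _ => h i)

theorem exists_single_ne_zero {m : ℕ} {g : (Fin m → ℝ) →ₗ[ℝ] ℝ} (hg : g ≠ 0) :
    ∃ j, g (Pi.single j 1) ≠ 0 := by
  by_contra! h
  refine hg (LinearMap.pi_ext' fun i => LinearMap.ext_ring ?_)
  simpa using h i

/-- A strip of width `O(1/k)` around a hyperplane contains few points of `P(k)`. -/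
theorem negligible_strip {m : ℕ} {P : Set (Fin m → ℝ)} {B : ℕ} (hB : ∀ x ∈ P, ∀ i, |x i| ≤ B)
    (f : (Fin m → ℝ) →ᵃ[ℝ] ℝ) (hf : f.linear ≠ 0) (C : ℝ) :
    Negligible P (fun k => {x | |f x| ≤ C / k}) := by
  obtain ⟨j, hj⟩ := exists_single_ne_zero hf
  set a := f.linear (Pi.single j 1) with ha
  -- On the strip `k * f x / a` has absolute value at most `C / |a|`; the extra 1 allows for
  -- rounding down a negative value.
  set M : ℕ := ⌈C / |a|⌉₊ + 1 with hM
  refine ⟨(2 * M + 2 * B + 2 : ℝ) ^ m, fun k hk => ?_⟩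
  have hk0 : (0 : ℝ) < k := by exact_mod_cast hk
  have hk1 : (1 : ℝ) ≤ k := by exact_mod_cast hk
  -- The `j`-th coordinate is replaced by a rounded height. When the other coordinates agree, the
  -- scaled heights of two lattice points differ by the integer `k * (x j - y j)`, so rounding loses
  -- nothing and `φ` is injective on the strip.
  let φ : (Fin m → ℝ) → Fin m → ℤ := fun x i =>
    if i = j then ⌊k * f x / a⌋ else ⌊(k : ℝ) * x i⌋
  let T : Finset (Fin m → ℤ) := Fintype.piFinset fun i =>
    if i = j then Finset.Icc (-(M : ℤ)) M else Finset.Icc (-(B * k : ℤ)) (B * k)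
  have hmaps : ∀ x ∈ {x | |f x| ≤ C / k} ∩ latticePoints P k, φ x ∈ (T : Set (Fin m → ℤ)) := by
    rintro x ⟨hx1, hx⟩
    simp only [Finset.mem_coe, T, Fintype.mem_piFinset]
    intro i
    by_cases hij : i = j
    · simp only [φ, hij, if_true, Finset.mem_Icc]
      have h1 : |k * f x / a| ≤ C / |a| := by
        rw [abs_div, abs_mul, abs_of_pos hk0]
        gcongr
        have := mul_le_mul_of_nonneg_left (show |f x| ≤ C / k from hx1) hk0.le
        rwa [mul_div_cancel₀ _ hk0.ne'] at this
      have h2 := abs_le.1 (h1.trans (Nat.le_ceil (C / |a|)))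
      constructor
      · rw [Int.le_floor, hM]; push_cast; linarith
      · have : ⌊k * f x / a⌋ ≤ ((⌈C / |a|⌉₊ : ℕ) : ℤ) := by
          have h3 := (Int.floor_le (k * f x / a)).trans h2.2
          exact_mod_cast h3
        rw [hM]; push_cast; omega
    · simp only [φ, hij, if_false, Finset.mem_Icc]
      have h := abs_le.1 (hB x hx.1 i)
      have e := latticePoints_floor hx i
      constructor
      · have : (-(B * k : ℤ) : ℝ) ≤ (⌊(k : ℝ) * x i⌋ : ℤ) := by rw [e]; push_cast; nlinarith
        exact_mod_cast this
      · have : ((⌊(k : ℝ) * x i⌋ : ℤ) : ℝ) ≤ ((B * k : ℤ) : ℝ) := by rw [e]; push_cast; nlinarith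
        exact_mod_cast this
  have hinj : InjOn φ ({x | |f x| ≤ C / k} ∩ latticePoints P k) := by
    rintro x ⟨_, hx⟩ y ⟨_, hy⟩ hxy
    have hne : ∀ i, i ≠ j → x i = y i := by
      intro i hi
      have h := congrFun hxy i
      simp only [φ, hi, if_false] at h
      have h2 : (k : ℝ) * x i = k * y i := by
        rw [← latticePoints_floor hx i, ← latticePoints_floor hy i, h]
      exact mul_left_cancel₀ hk0.ne' h2
    have hdiff : x - y = (x j - y j) • Pi.single j (1 : ℝ) := by
      ext i
      by_cases hi : i = j
      · subst hi; simp
      · simp [hi, hne i hi]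
    have hfd : f x - f y = (x j - y j) * a := by
      have := f.linearMap_vsub x y
      simp only [vsub_eq_sub] at this
      rw [← this, hdiff, map_smul, smul_eq_mul]
    have h := congrFun hxy j
    simp only [φ, if_true] at h
    obtain ⟨p, hp⟩ := hx.2 j
    obtain ⟨q, hq⟩ := hy.2 j
    have h4 : k * f x / a = k * f y / a + ((p - q : ℤ) : ℝ) := by
      push_cast
      rw [← hp, ← hq]
      field_simp
      linear_combination hfd
    rw [h4, Int.floor_add_intCast] at h
    have hpq : p = q := by omega
    have hj' : x j = y j := by
      rw [hpq, ← hq] at hp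
      exact mul_left_cancel₀ hk0.ne' hp
    ext i
    by_cases hi : i = j
    · rw [hi, hj']
    · exact hne i hi
  have hcard := ncard_le_ncard_of_injOn φ hmaps hinj T.finite_toSet
  rw [ncard_coe_finset, Fintype.card_piFinset] at hcard
  have hprod : ((∏ i : Fin m, (if i = j then Finset.Icc (-(M : ℤ)) M
      else Finset.Icc (-(B * k : ℤ)) (B * k)).card : ℕ) : ℝ) ≤
      (2 * M + 2 * B + 2 : ℝ) ^ m * ∏ i : Fin m, Function.update (fun _ => (k : ℝ)) j 1 i := by
    rw [Nat.cast_prod]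
    have : (2 * M + 2 * B + 2 : ℝ) ^ m = ∏ _i : Fin m, (2 * M + 2 * B + 2 : ℝ) := by simp
    rw [this, ← Finset.prod_mul_distrib]
    refine Finset.prod_le_prod (fun i _ => by positivity) fun i _ => ?_
    by_cases hi : i = j
    · have h1 : ((M : ℤ) + 1 - -(M : ℤ)).toNat = 2 * M + 1 := by omega
      simp only [hi, if_true, Int.card_Icc, Function.update_self, h1]
      push_cast
      have : (0 : ℝ) ≤ B := by positivity
      linarith
    · have h1 : ((B * k : ℤ) + 1 - -(B * k : ℤ)).toNat = 2 * (B * k) + 1 := by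
        have : (B * k : ℤ) = ((B * k : ℕ) : ℤ) := by push_cast; rfl
        rw [this]; omega
      simp only [hi, if_false, Int.card_Icc, Function.update_of_ne (f := fun _ => (k : ℝ)) hi, h1]
      push_cast
      have hM0 : (0 : ℝ) ≤ M := by positivity
      nlinarith
  -- The factor 1 at `j` saves one power of `k`; multiplying by `k` avoids the exponent `m - 1`.
  have hupd : (∏ i : Fin m, Function.update (fun _ => (k : ℝ)) j 1 i) * k = (k : ℝ) ^ m := by
    rw [Finset.prod_update_of_mem (Finset.mem_univ j), one_mul, mul_comm,
      Finset.sdiff_singleton_eq_erase, Finset.mul_prod_erase _ (fun _ => (k : ℝ)) (Finset.mem_univ j)]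
    simp
  calc _ ≤ ((2 * M + 2 * B + 2 : ℝ) ^ m *
        ∏ i : Fin m, Function.update (fun _ => (k : ℝ)) j 1 i) * k := by
        gcongr
        exact (Nat.cast_le.2 hcard).trans hprod
    _ = _ := by rw [mul_assoc, hupd]

theorem exists_hyperplane {m : ℕ} (H : AffineSubspace ℝ (Fin m → ℝ)) (hH : H ≠ ⊤)
    (hne : (H : Set (Fin m → ℝ)).Nonempty) :
    ∃ f : (Fin m → ℝ) →ᵃ[ℝ] ℝ, f.linear ≠ 0 ∧ ∀ x ∈ H, f x = 0 := by
  obtain ⟨p, hp⟩ := hne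
  have hd : H.direction ≠ ⊤ := by
    rwa [Ne, AffineSubspace.direction_eq_top_iff_of_nonempty ⟨p, hp⟩]
  obtain ⟨g, hg, hg'⟩ := Submodule.exists_le_ker_of_lt_top H.direction (lt_top_iff_ne_top.2 hd)
  refine ⟨g.toAffineMap - AffineMap.const ℝ _ (g p), by simpa using hg, fun x hx => ?_⟩
  have : x - p ∈ H.direction := AffineSubspace.vsub_mem_direction hx hp
  have := hg' this
  simpa [sub_eq_zero] using this

theorem negligible_of_codim {m : ℕ} {P : Set (Fin m → ℝ)} {B : ℕ}
    (hB : ∀ x ∈ P, ∀ i, |x i| ≤ B) {A : Set (Fin m → ℝ)} (hA : CodimAtLeastOne A) :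
    Negligible P (fun _ => A) := by
  obtain ⟨𝓗, hfin, hne, hcov⟩ := hA
  refine (Negligible.biUnion hfin (E := fun H _ => (H : Set (Fin m → ℝ))) fun H hH => ?_).mono hB
    (fun k _ => inter_subset_left.trans hcov)
  rcases (H : Set (Fin m → ℝ)).eq_empty_or_nonempty with h0 | h0
  · rw [h0]; exact negligible_empty P
  · obtain ⟨f, hf, hf0⟩ := exists_hyperplane H (hne H hH) h0
    refine (negligible_strip hB f hf 0).mono hB fun k _ x hx => ?_
    simp [hf0 x hx.1]

/-! ### Lattice approximation of a polytope, and the rank of `P(k)` -/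

theorem IsFullDimPolytope.bounded {m : ℕ} {P : Set (Fin m → ℝ)} (hP : IsFullDimPolytope P) :
    ∃ B : ℕ, ∀ x ∈ P, ∀ i, |x i| ≤ B := by
  obtain ⟨𝒱, -, -, rfl⟩ := hP
  have hb : Bornology.IsBounded (⋃ V ∈ 𝒱, convexHull ℝ (V : Set (Fin m → ℝ))) :=
    (Bornology.isBounded_biUnion_finset 𝒱).2 fun V _ =>
      isBounded_convexHull.2 V.finite_toSet.isBounded
  obtain ⟨r, hr⟩ := hb.exists_norm_le
  obtain ⟨B, hB⟩ := exists_nat_ge r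
  exact ⟨B, fun x hx i => (norm_le_pi_norm x i).trans ((hr x hx).trans hB)⟩

theorem IsFullDimPolytope.nonempty {m : ℕ} {P : Set (Fin m → ℝ)} (hP : IsFullDimPolytope P) :
    P.Nonempty := by
  obtain ⟨𝒱, ⟨V, hV⟩, h, rfl⟩ := hP
  obtain ⟨x, hx⟩ := h V hV
  exact ⟨x, mem_biUnion (x := V) hV (interior_subset hx)⟩

theorem ceil_lattice {k : ℕ} (hk : 1 ≤ k) (t : ℝ) :
    0 ≤ (⌈k * t⌉ : ℝ) / k - t ∧ (⌈k * t⌉ : ℝ) / k - t ≤ 1 / k := by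
  have hk0 : (0 : ℝ) < k := by exact_mod_cast hk
  have e : (⌈k * t⌉ : ℝ) / k - t = (⌈k * t⌉ - k * t) / k := by field_simp
  have h1 := Int.le_ceil (k * t)
  have h2 := Int.ceil_lt_add_one (k * t)
  rw [e]
  constructor
  · apply div_nonneg <;> linarith
  · gcongr; linarith

/-- Every point of a polytope is approximated up to `O(1/k)` by a point of `P(k)`. -/
theorem IsFullDimPolytope.approx {m : ℕ} {P : Set (Fin m → ℝ)} (hP : IsFullDimPolytope P) :
    ∃ (K₀ : ℕ) (K : ℝ), 1 ≤ K₀ ∧ ∀ k ≥ K₀, ∀ x ∈ P, ∃ y ∈ latticePoints P k,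
      ∀ i, |x i - y i| ≤ K / k := by
  obtain ⟨B, hB⟩ := hP.bounded
  obtain ⟨𝒱, -, hint, rfl⟩ := hP
  have hball : ∃ ε > 0, ∀ V ∈ 𝒱, ∃ y, Metric.closedBall y ε ⊆ convexHull ℝ (V : Set (Fin m → ℝ)) := by
    have : ∀ᶠ ε in nhdsWithin (0 : ℝ) (Ioi 0), ∀ V ∈ 𝒱, ∃ y,
        Metric.closedBall y ε ⊆ convexHull ℝ (V : Set (Fin m → ℝ)) := by
      rw [Filter.eventually_all_finset]
      intro V hV
      obtain ⟨y, hy⟩ := hint V hV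
      obtain ⟨ε, hε, hy'⟩ := Metric.nhds_basis_closedBall.mem_iff.1 (mem_interior_iff_mem_nhds.1 hy)
      filter_upwards [Ioc_mem_nhdsGT hε] with δ hδ
      exact ⟨y, (Metric.closedBall_subset_closedBall hδ.2).trans hy'⟩
    obtain ⟨ε, h1, h2⟩ := (this.and self_mem_nhdsWithin).exists
    exact ⟨ε, h2, h1⟩
  obtain ⟨ε, hε, hball⟩ := hball
  obtain ⟨K₀, hK₀⟩ := exists_nat_ge (1 / ε)
  refine ⟨K₀ + 1, 2 * B / ε + 1, by omega, fun k hk x hx => ?_⟩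
  have hk1 : 1 ≤ k := by omega
  have hk0 : (0 : ℝ) < k := by exact_mod_cast hk1
  have hkε : 1 ≤ k * ε := by
    have : 1 / ε ≤ k := hK₀.trans (by exact_mod_cast (by omega : K₀ ≤ k))
    rwa [div_le_iff₀ hε] at this
  obtain ⟨V, hV, hxV⟩ := mem_iUnion₂.1 hx
  obtain ⟨y, hy⟩ := hball V hV
  -- Moving `x` towards the centre `y` by the proportion `s` gives a point `c` around which a ball
  -- of radius `s * ε = 1 / k` fits into the hull, enough room to round `c` to a lattice point.
  set s : ℝ := 1 / (k * ε) with hs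
  have hs0 : 0 < s := by positivity
  have hs1 : s ≤ 1 := by rw [hs, div_le_one (by positivity)]; exact hkε
  let c : Fin m → ℝ := fun i => (1 - s) * x i + s * y i
  let w : Fin m → ℝ := fun i => (⌈k * c i⌉ : ℝ) / k
  have hwc : ∀ i, |w i - c i| ≤ 1 / k := fun i => by
    rw [abs_of_nonneg (ceil_lattice hk1 (c i)).1]; exact (ceil_lattice hk1 (c i)).2
  have hq : (fun i => y i + (w i - c i) / s) ∈ convexHull ℝ (V : Set (Fin m → ℝ)) := by
    apply hy
    rw [Metric.mem_closedBall, dist_pi_le_iff hε.le]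
    intro i
    rw [Real.dist_eq, add_sub_cancel_left, abs_div, abs_of_pos hs0, div_le_iff₀ hs0]
    refine (hwc i).trans (le_of_eq ?_)
    rw [hs]; field_simp
  have hwV : w ∈ convexHull ℝ (V : Set (Fin m → ℝ)) := by
    have := convex_convexHull ℝ (V : Set (Fin m → ℝ)) hxV hq (sub_nonneg.2 hs1) hs0.le (by ring)
    convert this using 1
    ext i
    simp only [Pi.add_apply, Pi.smul_apply, smul_eq_mul]
    field_simp
    simp only [c]; ring
  have hyP : y ∈ ⋃ V ∈ 𝒱, convexHull ℝ (V : Set (Fin m → ℝ)) :=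
    mem_biUnion (x := V) hV (hy (Metric.mem_closedBall_self hε.le))
  refine ⟨w, ⟨mem_biUnion (x := V) hV hwV, fun i => ⟨⌈k * c i⌉, ?_⟩⟩, fun i => ?_⟩
  · simp only [w]; field_simp
  · have h1 : x i - w i = s * (x i - y i) - (w i - c i) := by simp only [c]; ring
    have h2 := abs_le.1 (hB x hx i)
    have h3 := abs_le.1 (hB y hyP i)
    have h4 : |x i - y i| ≤ 2 * B := abs_le.2 ⟨by linarith, by linarith⟩
    rw [h1]
    calc _ ≤ |s * (x i - y i)| + |w i - c i| := abs_sub _ _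
      _ ≤ s * (2 * B) + 1 / k := by
        rw [abs_mul, abs_of_pos hs0]
        exact add_le_add (mul_le_mul_of_nonneg_left h4 hs0.le) (hwc i)
      _ = _ := by rw [hs]; field_simp

/-- A set with interior points contains at least `c k ^ m` points of the lattice. -/
theorem exists_le_ncard_latticePoints {m : ℕ} {P : Set (Fin m → ℝ)} (hP : IsFullDimPolytope P) :
    ∃ (K₀ : ℕ) (c : ℝ), 0 < c ∧ ∀ k ≥ K₀, c * (k : ℝ) ^ m ≤ (latticePoints P k).ncard := by
  obtain ⟨B, hB⟩ := hP.bounded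
  obtain ⟨𝒱, ⟨V, hV⟩, hint, rfl⟩ := hP
  obtain ⟨y, hy⟩ := hint V hV
  obtain ⟨ε, hε, hy'⟩ := Metric.nhds_basis_closedBall.mem_iff.1 (mem_interior_iff_mem_nhds.1 hy)
  obtain ⟨K₀, hK₀⟩ := exists_nat_ge (1 / ε)
  -- A cube with `n = ⌊k * ε⌋₊` lattice points per side fits into the ball, and `n ≥ k * ε / 2`
  -- because `n ≥ 1`.
  refine ⟨K₀ + 1, (ε / 2) ^ m, by positivity, fun k hk => ?_⟩
  have hk1 : 1 ≤ k := by omega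
  have hk0 : (0 : ℝ) < k := by exact_mod_cast hk1
  have hkε : 1 ≤ k * ε := by
    have : 1 / ε ≤ k := hK₀.trans (by exact_mod_cast (by omega : K₀ ≤ k))
    rwa [div_le_iff₀ hε] at this
  set n := ⌊k * ε⌋₊ with hn
  have hn1 : 1 ≤ n := by rw [hn]; exact Nat.le_floor (by simpa using hkε)
  have hnle : (n : ℝ) ≤ k * ε := Nat.floor_le (by positivity)
  have hnlt : k * ε < n + 1 := Nat.lt_floor_add_one _
  let ψ : (Fin m → Fin n) → Fin m → ℝ := fun z i => (⌈k * y i⌉ + (z i : ℕ) : ℝ) / k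
  have hψ : ∀ z, ψ z ∈ latticePoints (⋃ V ∈ 𝒱, convexHull ℝ (V : Set (Fin m → ℝ))) k := by
    intro z
    refine ⟨mem_biUnion (x := V) hV (hy' ?_), fun i => ⟨⌈k * y i⌉ + (z i : ℕ), ?_⟩⟩
    · rw [Metric.mem_closedBall, dist_pi_le_iff hε.le]
      intro i
      have h := ceil_lattice hk1 (y i)
      have hz : ((z i : ℕ) : ℝ) + 1 ≤ n := by exact_mod_cast (z i).2
      have hz0 : (0 : ℝ) ≤ ((z i : ℕ) : ℝ) / k := by positivity
      have h5 : (1 : ℝ) / k + ((z i : ℕ) : ℝ) / k ≤ ε := by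
        rw [← add_div, div_le_iff₀ hk0]; linarith
      rw [Real.dist_eq, show ψ z i - y i = ((⌈k * y i⌉ : ℝ) / k - y i) + ((z i : ℕ) : ℝ) / k by
        simp only [ψ]; ring, abs_of_nonneg (by linarith)]
      linarith
    · simp only [ψ]; push_cast; field_simp
  have hinj : Function.Injective ψ := by
    intro z z' h
    ext i
    have h := congrFun h i
    simp only [ψ] at h
    field_simp at h
    have := add_left_cancel h
    exact_mod_cast this
  have hcard : n ^ m ≤
      (latticePoints (⋃ V ∈ 𝒱, convexHull ℝ (V : Set (Fin m → ℝ))) k).ncard := by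
    have h1 := ncard_le_ncard (range_subset_iff.2 hψ) (finite_latticePoints hB hk1)
    rw [← image_univ, ncard_image_of_injective _ hinj, ncard_univ] at h1
    simpa using h1
  calc (ε / 2) ^ m * (k : ℝ) ^ m = (ε / 2 * k) ^ m := (mul_pow _ _ _).symm
    _ ≤ (n : ℝ) ^ m := by
      gcongr
      have : (1 : ℝ) ≤ n := by exact_mod_cast hn1
      linarith
    _ ≤ _ := by exact_mod_cast hcard

theorem abs_rk_sub_le {m : ℕ} {x y : Fin m → ℝ} {c : ℝ} (h : ∀ i, |x i - y i| ≤ c) :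
    |rk x - rk y| ≤ m * c := by
  rw [rk, rk, ← Finset.sum_sub_distrib]
  refine (Finset.abs_sum_le_sum_abs _ _).trans ((Finset.sum_le_sum fun i _ => h i).trans ?_)
  simp

/-- The rank of `P(k)` is an integral multiple of `1/k` and differs from the rank of `P` by
`O(1/k)`. -/
theorem exists_setRank_latticePoints {m : ℕ} {P : Set (Fin m → ℝ)} (hP : IsFullDimPolytope P) :
    ∃ (K₀ : ℕ) (K : ℝ), 1 ≤ K₀ ∧ ∀ k ≥ K₀,
      |setRank (latticePoints P k) - setRank P| ≤ K / k ∧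
      ∃ z : ℤ, (k : ℝ) * setRank (latticePoints P k) = z := by
  obtain ⟨B, hB⟩ := hP.bounded
  obtain ⟨K₀, K, hK₀, happ⟩ := hP.approx
  -- The maximum and the minimum rank each move by at most `m * K / k`.
  refine ⟨K₀, 2 * (m * K), hK₀, fun k hk => ?_⟩
  have hk1 : 1 ≤ k := by omega
  have hk0 : (0 : ℝ) < k := by exact_mod_cast hk1
  have hrk : ∀ x ∈ P, |rk x - rk 0| ≤ m * (B : ℝ) := fun x hx =>
    abs_rk_sub_le fun i => by simpa using hB x hx i
  have hrk0 : rk (0 : Fin m → ℝ) = 0 := by simp [rk]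
  have hup : ∀ x ∈ P, rk x ≤ m * B := fun x hx => by
    have := (abs_le.1 (hrk x hx)).2; linarith
  have hlo : ∀ x ∈ P, -(m * B) ≤ rk x := fun x hx => by
    have := (abs_le.1 (hrk x hx)).1; linarith
  have hsub : latticePoints P k ⊆ P := fun x hx => hx.1
  have hPne := hP.nonempty
  have hLne : (latticePoints P k).Nonempty := by
    obtain ⟨x, hx⟩ := hPne
    obtain ⟨y, hy, -⟩ := happ k hk x hx
    exact ⟨y, hy⟩
  have hbA : BddAbove (rk '' P) := ⟨m * B, forall_mem_image.2 hup⟩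
  have hbB : BddBelow (rk '' P) := ⟨-(m * B), forall_mem_image.2 hlo⟩
  have hLA := hbA.mono (image_mono hsub)
  have hLB := hbB.mono (image_mono hsub)
  have h1 : sSup (rk '' latticePoints P k) ≤ sSup (rk '' P) :=
    csSup_le_csSup hbA (hLne.image _) (image_mono hsub)
  have h2 : sInf (rk '' P) ≤ sInf (rk '' latticePoints P k) :=
    csInf_le_csInf hbB (hLne.image _) (image_mono hsub)
  have h3 : sSup (rk '' P) ≤ sSup (rk '' latticePoints P k) + m * (K / k) := by
    refine csSup_le (hPne.image _) (forall_mem_image.2 fun x hx => ?_)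
    obtain ⟨y, hy, hxy⟩ := happ k hk x hx
    have := (abs_le.1 (abs_rk_sub_le hxy)).2
    have := le_csSup hLA (mem_image_of_mem rk hy)
    linarith
  have h4 : sInf (rk '' latticePoints P k) - m * (K / k) ≤ sInf (rk '' P) := by
    refine le_csInf (hPne.image _) (forall_mem_image.2 fun x hx => ?_)
    obtain ⟨y, hy, hxy⟩ := happ k hk x hx
    have := (abs_le.1 (abs_rk_sub_le hxy)).1
    have := csInf_le hLB (mem_image_of_mem rk hy)
    linarith
  have h5 : 2 * (m * K) / k = m * (K / k) + m * (K / k) := by ring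
  refine ⟨?_, ?_⟩
  · rw [setRank, setRank, abs_le, h5]
    constructor <;> linarith
  · have hfin := (finite_latticePoints hB hk1).image rk
    obtain ⟨x, hx, hx'⟩ := (hLne.image rk).csSup_mem hfin
    obtain ⟨y, hy, hy'⟩ := (hLne.image rk).csInf_mem hfin
    refine ⟨∑ i, ⌊k * x i⌋ + ∑ i, ⌊k * y i⌋, ?_⟩
    rw [setRank, ← hx', ← hy', mul_add, rk, rk, Finset.mul_sum, Finset.mul_sum]
    push_cast
    congr 1
    · exact Finset.sum_congr rfl fun i _ => (latticePoints_floor hx i).symm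
    · exact Finset.sum_congr rfl fun i _ => (latticePoints_floor hy i).symm

/-! ### Tracks: swipes in affine coordinates -/

theorem AffineMap.map_add_linear {m : ℕ} (f : (Fin m → ℝ) →ᵃ[ℝ] ℝ) (x v : Fin m → ℝ) :
    f (x + v) = f x + f.linear v := by
  have := f.map_vadd x v
  simpa [add_comm] using this

theorem rk_add_smul_single {m : ℕ} (x : Fin m → ℝ) (t : ℝ) (i : Fin m) :
    rk (x + t • Pi.single i (1 : ℝ)) = rk x + t := by
  simp [rk, Finset.sum_add_distrib, ← Finset.mul_sum]

/-- A sequence of swipes described by affine coordinates, and prolonged by degenerate swipes. The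
`i`-th swipe has direction `dir i` and consists of the points at which the barycentric coordinates
`β i` and the height `h i` above its starting set are non-negative, while the height `h (i + 1)`
above its ending set is non-positive. -/
structure Track (m : ℕ) where
  d : ℕ
  last : ℕ
  dir : ℕ → Fin m
  h : ℕ → (Fin m → ℝ) →ᵃ[ℝ] ℝ
  β : ℕ → Fin (d + 1) → (Fin m → ℝ) →ᵃ[ℝ] ℝ
  h_dir : ∀ i, (h i).linear (Pi.single (dir i) 1) = 1
  h_succ_dir : ∀ i, (h (i + 1)).linear (Pi.single (dir i) 1) = 1
  β_dir : ∀ i a, (β i a).linear (Pi.single (dir i) 1) = 0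
  β_eq_one : ∀ i a, (β i a).linear = 0 → ∀ x, β i a x = 1
  h_succ_le : ∀ i x, (∀ a, 0 ≤ β i a x) → h (i + 1) x ≤ h i x
  β_sub : ∀ i < last, ∀ a, ∃ κ : ℝ, ∀ x, β i a x - β (i + 1) a x = κ * h (i + 1) x
  rkStart : Fin (d + 1) → ℝ
  rkEnd : Fin (d + 1) → ℝ
  rk_eq_start : ∀ x, rk x = ∑ a, β 0 a x * rkStart a + h 0 x
  rk_eq_end : ∀ x, rk x = ∑ a, β last a x * rkEnd a + h (last + 1) x
  sum_β : ∀ i x, ∑ a, β i a x = 1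

namespace Track

variable {m : ℕ} (T : Track m) (k : ℕ)

/-- The points with positive barycentric coordinates that lie strictly after the start and not
after the end of the `i`-th swipe. -/
def Cell (i : ℕ) (x : Fin m → ℝ) : Prop :=
  (∀ a, 0 < T.β i a x) ∧ 0 < T.h i x ∧ T.h (i + 1) x ≤ 0

/-- The points `x` and `y` lie on a common lattice line in the `i`-th direction. -/
def Line (i : ℕ) (x y : Fin m → ℝ) : Prop :=
  ∃ n : ℤ, y = x + ((n : ℝ) / k) • Pi.single (T.dir i) (1 : ℝ)

/-- A sequence of lattice points, the `j`-th one just before the `j`-th turning hyperplane, such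
that consecutive points are on common lattice lines. -/
structure IsTurning (z : ℕ → Fin m → ℝ) : Prop where
  lat : ∀ i, ∃ n : ℤ, (k : ℝ) * z 0 i = n
  lower : ∀ j, -(1 / k) < T.h j (z j)
  upper : ∀ j, T.h j (z j) ≤ 0
  line : ∀ j, T.Line k j (z j) (z (j + 1))

/-- All the turning points are in the interior of the swipes. -/
def IsInner (z : ℕ → Fin m → ℝ) : Prop := ∀ j ≤ T.last, ∀ a, 0 < T.β j a (z j)

/-- The points on the lattice path with turning points `z` whose rank is in the given interval. -/
def chain (R A : ℝ) (z : ℕ → Fin m → ℝ) : Set (Fin m → ℝ) :=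
  {x | (∃ i ≤ T.last, T.Line k i (z i) x ∧ T.Cell i x) ∧
    rk (z 0) + A / k ≤ rk x ∧ rk x ≤ R - rk (z 0) - A / k}

variable {T k}

theorem h_add (i : ℕ) (x : Fin m → ℝ) (t : ℝ) :
    T.h i (x + t • Pi.single (T.dir i) (1 : ℝ)) = T.h i x + t := by
  rw [AffineMap.map_add_linear, map_smul, T.h_dir, smul_eq_mul, mul_one]

theorem h_succ_add (i : ℕ) (x : Fin m → ℝ) (t : ℝ) :
    T.h (i + 1) (x + t • Pi.single (T.dir i) (1 : ℝ)) = T.h (i + 1) x + t := by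
  rw [AffineMap.map_add_linear, map_smul, T.h_succ_dir, smul_eq_mul, mul_one]

theorem β_add (i : ℕ) (a) (x : Fin m → ℝ) (t : ℝ) :
    T.β i a (x + t • Pi.single (T.dir i) (1 : ℝ)) = T.β i a x := by
  rw [AffineMap.map_add_linear, map_smul, T.β_dir, smul_zero, add_zero]

theorem Line.symm {i : ℕ} {x y : Fin m → ℝ} (h : T.Line k i x y) : T.Line k i y x := by
  obtain ⟨n, rfl⟩ := h
  exact ⟨-n, by push_cast; module⟩

theorem Line.trans {i : ℕ} {x y z : Fin m → ℝ} (h : T.Line k i x y) (h' : T.Line k i y z) :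
    T.Line k i x z := by
  obtain ⟨n, rfl⟩ := h
  obtain ⟨n', rfl⟩ := h'
  exact ⟨n + n', by push_cast; module⟩

theorem Line.β_eq {i : ℕ} {x y : Fin m → ℝ} (h : T.Line k i x y) (a) : T.β i a y = T.β i a x := by
  obtain ⟨n, rfl⟩ := h
  exact T.β_add i a x _

theorem Line.lat (hk : 1 ≤ k) {i : ℕ} {x y : Fin m → ℝ} (h : T.Line k i x y)
    (hx : ∀ l, ∃ n : ℤ, (k : ℝ) * x l = n) : ∀ l, ∃ n : ℤ, (k : ℝ) * y l = n := by
  intro l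
  have hk0 : (0 : ℝ) < k := by exact_mod_cast hk
  obtain ⟨n, rfl⟩ := h
  obtain ⟨p, hp⟩ := hx l
  by_cases hl : l = T.dir i
  · refine ⟨p + n, ?_⟩
    subst hl
    simp only [Pi.add_apply, Pi.smul_apply, Pi.single_eq_same, smul_eq_mul, mul_one, mul_add, hp]
    push_cast; field_simp
  · exact ⟨p, by simp [hl, hp]⟩

/-- The half-open window `(-1/k, 0]` has length `1/k`, so it cannot contain two distinct heights
differing by a multiple of `1/k`. Together with `floor_shift` this makes the turning point on a
lattice line exist and be unique. -/
theorem int_eq_of_div_lt (hk : 1 ≤ k) {n : ℤ} {s t : ℝ} (hs : -(1 / k) < s) (hs' : s ≤ 0)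
    (ht : -(1 / k) < t) (ht' : t ≤ 0) (h : t = s + (n : ℝ) / k) : n = 0 := by
  have hk0 : (0 : ℝ) < k := by exact_mod_cast hk
  have h1 : (n : ℝ) / k < 1 / k := by linarith
  have h2 : (-1 : ℝ) / k < n / k := by rw [neg_div]; linarith
  rw [div_lt_div_iff_of_pos_right hk0] at h1 h2
  have h1 : n < 1 := by exact_mod_cast h1
  have h2 : -1 < n := by exact_mod_cast h2
  omega

theorem Line.eq (hk : 1 ≤ k) {i : ℕ} {x y : Fin m → ℝ} (h : T.Line k i x y)
    (hx : -(1 / k) < T.h i x) (hx' : T.h i x ≤ 0) (hy : -(1 / k) < T.h i y) (hy' : T.h i y ≤ 0) :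
    y = x := by
  obtain ⟨n, rfl⟩ := h
  rw [int_eq_of_div_lt hk hx hx' hy hy' (T.h_add i x _)]
  simp

theorem Line.eq_of_succ (hk : 1 ≤ k) {i : ℕ} {x y : Fin m → ℝ} (h : T.Line k i x y)
    (hx : -(1 / k) < T.h (i + 1) x) (hx' : T.h (i + 1) x ≤ 0)
    (hy : -(1 / k) < T.h (i + 1) y) (hy' : T.h (i + 1) y ≤ 0) : y = x := by
  obtain ⟨n, rfl⟩ := h
  rw [int_eq_of_div_lt hk hx hx' hy hy' (T.h_succ_add i x _)]
  simp

theorem floor_shift (hk : 1 ≤ k) (s : ℝ) :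
    -(1 / k) < s + ((⌊-(k * s)⌋ : ℤ) : ℝ) / k ∧ s + ((⌊-(k * s)⌋ : ℤ) : ℝ) / k ≤ 0 := by
  have hk0 : (0 : ℝ) < k := by exact_mod_cast hk
  have h1 := Int.floor_le (-(k * s))
  have h2 := Int.lt_floor_add_one (-(k * s))
  have e : s + ((⌊-(k * s)⌋ : ℤ) : ℝ) / k = (k * s + ⌊-(k * s)⌋) / k := by field_simp
  rw [e]
  constructor
  · rw [← neg_div, div_lt_div_iff_of_pos_right hk0]; linarith
  · apply div_nonpos_of_nonpos_of_nonneg <;> linarith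

theorem exists_line_start (hk : 1 ≤ k) (i : ℕ) (x : Fin m → ℝ) :
    ∃ y, T.Line k i x y ∧ -(1 / k) < T.h i y ∧ T.h i y ≤ 0 := by
  refine ⟨_, ⟨⌊-(k * T.h i x)⌋, rfl⟩, ?_⟩
  rw [T.h_add]
  exact floor_shift hk _

theorem exists_line_end (hk : 1 ≤ k) (i : ℕ) (x : Fin m → ℝ) :
    ∃ y, T.Line k i x y ∧ -(1 / k) < T.h (i + 1) y ∧ T.h (i + 1) y ≤ 0 := by
  refine ⟨_, ⟨⌊-(k * T.h (i + 1) x)⌋, rfl⟩, ?_⟩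
  rw [T.h_succ_add]
  exact floor_shift hk _

/-! ### Existence and uniqueness of turning sequences -/

/-- Forward continuation is by recursion. Backwards, `w` is first moved along the previous direction
to the preceding window; the sequence through that point must return to `w` by uniqueness on the
line. -/
theorem exists_turning_of_turning_point (hk : 1 ≤ k) (i : ℕ) : ∀ (w : Fin m → ℝ),
    (∀ l, ∃ n : ℤ, (k : ℝ) * w l = n) → -(1 / k) < T.h i w → T.h i w ≤ 0 →
    ∃ z, T.IsTurning k z ∧ z i = w := by
  induction i with
  | zero =>
    intro w hw h1 h2
    choose f hf using fun i x => T.exists_line_end hk i x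
    let z : ℕ → Fin m → ℝ := fun j => Nat.rec w (fun j y => f j y) j
    refine ⟨z, ⟨hw, fun j => ?_, fun j => ?_, fun j => (hf j (z j)).1⟩, rfl⟩
    · cases j with
      | zero => exact h1
      | succ j => exact (hf j (z j)).2.1
    · cases j with
      | zero => exact h2
      | succ j => exact (hf j (z j)).2.2
  | succ i ih =>
    intro w hw h1 h2
    obtain ⟨v, hv, hv1, hv2⟩ := T.exists_line_start hk i w
    obtain ⟨z, hz, hzi⟩ := ih v (hv.lat hk hw) hv1 hv2
    refine ⟨z, hz, ?_⟩
    refine (hv.trans (hzi ▸ hz.line i)).eq_of_succ hk h1 h2 (hz.lower _) (hz.upper _)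

theorem exists_turning_through (hk : 1 ≤ k) (i : ℕ) (x : Fin m → ℝ)
    (hx : ∀ l, ∃ n : ℤ, (k : ℝ) * x l = n) : ∃ z, T.IsTurning k z ∧ T.Line k i (z i) x := by
  obtain ⟨w, hw, hw1, hw2⟩ := T.exists_line_start hk i x
  obtain ⟨z, hz, hzi⟩ := exists_turning_of_turning_point hk i w (hw.lat hk hx) hw1 hw2
  exact ⟨z, hz, hzi ▸ hw.symm⟩

/-- Each turning point determines the next and the previous one, since both are the unique window
points on a lattice line through it. -/
theorem IsTurning.ext (hk : 1 ≤ k) {z z' : ℕ → Fin m → ℝ} (hz : T.IsTurning k z)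
    (hz' : T.IsTurning k z') {i : ℕ} (h : z i = z' i) : z = z' := by
  have up : ∀ j, z j = z' j → z (j + 1) = z' (j + 1) := fun j hj =>
    ((hz'.line j).symm.trans (hj ▸ hz.line j)).eq_of_succ hk (hz'.lower _) (hz'.upper _)
      (hz.lower _) (hz.upper _)
  have down : ∀ j, z (j + 1) = z' (j + 1) → z j = z' j := fun j hj =>
    ((hz'.line j).trans (hj ▸ (hz.line j).symm)).eq hk (hz'.lower _) (hz'.upper _)
      (hz.lower _) (hz.upper _)
  have h0 : z 0 = z' 0 := by
    clear up
    induction i with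
    | zero => exact h
    | succ i ih => exact ih (down i h)
  ext1 j
  induction j with
  | zero => exact h0
  | succ j ih => exact up j ih

/-- A point at height 0 for all later turns is itself in every later window, so the sequence stays
there. This is how halted points are recognised. -/
theorem IsTurning.eq_last {z : ℕ → Fin m → ℝ} (hk : 1 ≤ k) (hz : T.IsTurning k z) {i : ℕ}
    {x : Fin m → ℝ} (hx : T.Line k i (z i) x) (h : ∀ l, i < l → T.h l x = 0) :
    ∀ l, i < l → z l = x := by
  have hk0 : (0 : ℝ) < 1 / k := by positivity
  have h0 : ∀ l, i < l → -(1 / (k : ℝ)) < T.h l x ∧ T.h l x ≤ 0 := fun l hl => by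
    rw [h l hl]; constructor <;> linarith
  intro l hl
  induction l, hl using Nat.le_induction with
  | base =>
    exact (hx.symm.trans (hz.line i)).eq_of_succ hk (h0 _ (by omega)).1 (h0 _ (by omega)).2
      (hz.lower _) (hz.upper _)
  | succ l hl ih =>
    have hl' : i < l := hl
    exact (ih ▸ hz.line l).eq_of_succ hk (h0 _ (by omega)).1 (h0 _ (by omega)).2
      (hz.lower _) (hz.upper _)

/-! ### Lattice paths -/

/-- `γ 0, …, γ N` is the lattice path with the first `j` legs of the turning sequence `z`. -/
structure IsPath (T : Track m) (k : ℕ) (z : ℕ → Fin m → ℝ) (j N : ℕ) (γ : ℕ → Fin m → ℝ) :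
    Prop where
  zero : γ 0 = z 0
  last : γ N = z j
  step : ∀ n < N, ∃ i < j, T.Line k i (z i) (γ (n + 1)) ∧ T.Cell i (γ (n + 1)) ∧
    γ (n + 1) = γ n + (1 / k : ℝ) • Pi.single (T.dir i) (1 : ℝ)
  surj : ∀ i < j, ∀ x, T.Line k i (z i) x → T.Cell i x → ∃ n < N, γ (n + 1) = x

/-- Positive barycentric coordinates force each leg to run upwards or be trivial. The lattice points
strictly after its start and up to its end are exactly the points of its line in the cell, so
successive legs concatenate without repeating the turning point. -/
theorem IsTurning.exists_path (hk : 1 ≤ k) {z : ℕ → Fin m → ℝ} (hz : T.IsTurning k z)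
    (hin : T.IsInner z) (j : ℕ) (hj : j ≤ T.last + 1) : ∃ N γ, T.IsPath k z j N γ := by
  have hk0 : (0 : ℝ) < k := by exact_mod_cast hk
  induction j with
  | zero => exact ⟨0, fun _ => z 0, rfl, rfl, by simp, by simp⟩
  | succ j ih =>
    obtain ⟨N, γ, h0, hN, hstep, hsurj⟩ := ih (by omega)
    obtain ⟨n, hn⟩ := hz.line j
    have hβ := hin j (by omega)
    have hle := T.h_succ_le j (z j) fun a => (hβ a).le
    have hlow := hz.lower (j + 1)
    have hupp := hz.upper (j + 1)
    have hlow' := hz.lower j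
    have hupp' := hz.upper j
    have hhs : ∀ t : ℝ, T.h (j + 1) (z j + (t / k) • Pi.single (T.dir j) (1 : ℝ)) =
        T.h (j + 1) (z (j + 1)) + (t - n) / k := fun t => by
      rw [hn, T.h_succ_add, T.h_succ_add]; ring
    -- The height of `z j` over the next turn is at most 0, while that of `z (j + 1)` exceeds
    -- `-1/k`; hence `n > -1`.
    have hn0 : 0 ≤ n := by
      have h1 : T.h (j + 1) (z (j + 1)) = T.h (j + 1) (z j) + n / k := by
        rw [hn, T.h_succ_add]
      have h2 : (-1 : ℝ) / k < n / k := by rw [neg_div]; linarith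
      rw [div_lt_div_iff_of_pos_right hk0] at h2
      have : -1 < n := by exact_mod_cast h2
      omega
    obtain ⟨p, rfl⟩ := Int.eq_ofNat_of_zero_le hn0
    rw [Int.cast_natCast] at hn
    let γ' : ℕ → Fin m → ℝ := fun q =>
      if q ≤ N then γ q else z j + (((q - N : ℕ) : ℝ) / k) • Pi.single (T.dir j) (1 : ℝ)
    have hγ1 : ∀ q ≤ N, γ' q = γ q := fun q hq => by simp [γ', hq]
    have hγ2 : ∀ q, γ' (N + q) = z j + ((q : ℝ) / k) • Pi.single (T.dir j) (1 : ℝ) := fun q => by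
      rcases Nat.eq_zero_or_pos q with rfl | hq
      · simp [γ', hN]
      · simp only [γ']
        rw [if_neg (by omega), Nat.add_sub_cancel_left]
    refine ⟨N + p, γ', ?_, ?_, ?_, ?_⟩
    · rw [hγ1 0 (by omega), h0]
    · rw [hγ2, hn]
    · intro q hq
      rcases lt_or_ge q N with hqN | hqN
      · obtain ⟨i, hi, h1, h2, h3⟩ := hstep q hqN
        rw [hγ1 q (by omega), hγ1 (q + 1) (by omega)]
        exact ⟨i, by omega, h1, h2, h3⟩
      · obtain ⟨q, rfl⟩ := Nat.exists_eq_add_of_le hqN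
        have hqp : q + 1 ≤ p := by omega
        refine ⟨j, by omega, ?_, ?_, ?_⟩
        · exact ⟨q + 1, by rw [add_assoc, hγ2]; push_cast; rfl⟩
        · rw [add_assoc, hγ2]
          refine ⟨fun a => by rw [T.β_add]; exact hβ a, ?_, ?_⟩
          · rw [T.h_add]
            have : (1 : ℝ) / k ≤ ((q + 1 : ℕ) : ℝ) / k := by gcongr; push_cast; linarith [q.cast_nonneg (α := ℝ)]
            linarith
          · rw [hhs]
            have : (((q + 1 : ℕ) : ℝ) - ((p : ℤ) : ℝ)) / k ≤ 0 := by
              apply div_nonpos_of_nonpos_of_nonneg _ hk0.le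
              rw [sub_nonpos]; exact_mod_cast hqp
            linarith
        · rw [add_assoc, hγ2, hγ2]; push_cast; module
    · intro i hi x hx hcell
      rcases Nat.lt_succ_iff_lt_or_eq.1 hi with hi | rfl
      · obtain ⟨n, hn, h⟩ := hsurj i hi x hx hcell
        exact ⟨n, by omega, by rw [hγ1 _ (by omega), h]⟩
      · obtain ⟨q, rfl⟩ := hx
        have h1 := hcell.2.1
        have h2 := hcell.2.2
        rw [T.h_add] at h1
        rw [hhs] at h2
        have h3 : (0 : ℝ) / k < q / k := by rw [zero_div]; linarith
        rw [div_lt_div_iff_of_pos_right hk0] at h3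
        have h3 : 0 < q := by exact_mod_cast h3
        have h4 : (q - ((p : ℤ) : ℝ)) / k < 1 / k := by linarith
        rw [div_lt_div_iff_of_pos_right hk0] at h4
        have h4 : q - (p : ℤ) < 1 := by exact_mod_cast h4
        obtain ⟨r, rfl⟩ := Int.eq_ofNat_of_zero_le h3.le
        obtain ⟨r, rfl⟩ := Nat.exists_eq_succ_of_ne_zero (n := r) (by omega)
        refine ⟨N + r, by omega, ?_⟩
        rw [add_assoc, hγ2]
        simp

theorem IsPath.rk_eq {z : ℕ → Fin m → ℝ} {j N : ℕ} {γ : ℕ → Fin m → ℝ} (h : T.IsPath k z j N γ)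
    {n : ℕ} (hn : n ≤ N) : rk (γ n) = rk (z 0) + n / k := by
  induction n with
  | zero => simp [h.zero]
  | succ n ih =>
    obtain ⟨i, -, -, -, e⟩ := h.step n hn
    rw [e, rk_add_smul_single, ih (by omega)]
    push_cast; ring

/-- Affine functions vary slowly along lattice paths. -/
theorem IsPath.abs_sub_le {z : ℕ → Fin m → ℝ} {j N : ℕ} {γ : ℕ → Fin m → ℝ}
    (h : T.IsPath k z j N γ) (f : (Fin m → ℝ) →ᵃ[ℝ] ℝ) {n p : ℕ} (hn : n + p ≤ N) :
    |f (γ (n + p)) - f (γ n)| ≤ (∑ i, |f.linear (Pi.single i 1)|) * p / k := by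
  induction p with
  | zero => simp
  | succ p ih =>
    obtain ⟨i, -, -, -, e⟩ := h.step (n + p) (by omega)
    have h1 := ih (by omega)
    have h2 : f (γ (n + (p + 1))) - f (γ n) =
        (f (γ (n + p)) - f (γ n)) + 1 / k * f.linear (Pi.single (T.dir i) 1) := by
      rw [← add_assoc, e, AffineMap.map_add_linear, map_smul, smul_eq_mul]; ring
    have h3 : |f.linear (Pi.single (T.dir i) 1)| ≤ ∑ i, |f.linear (Pi.single i 1)| :=
      Finset.single_le_sum (f := fun i => |f.linear (Pi.single i 1)|) (fun _ _ => abs_nonneg _)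
        (Finset.mem_univ _)
    rw [h2]
    calc _ ≤ |f (γ (n + p)) - f (γ n)| + |1 / k * f.linear (Pi.single (T.dir i) 1)| :=
          abs_add_le _ _
      _ ≤ (∑ i, |f.linear (Pi.single i 1)|) * p / k + 1 / k * ∑ i, |f.linear (Pi.single i 1)| := by
        rw [abs_mul, abs_of_nonneg (by positivity : (0 : ℝ) ≤ 1 / k)]
        gcongr
      _ = _ := by push_cast; ring

/-! ### Error bounds along a path -/

/-- The barycentric coordinates of the turning points of one path differ by `O(1/k)`. -/
theorem exists_drift (T : Track m) : ∃ K : ℝ, 0 ≤ K ∧ ∀ k z, T.IsTurning k z →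
    ∀ i ≤ T.last, ∀ j ≤ T.last, ∀ a, |T.β j a (z j) - T.β i a (z i)| ≤ K / k := by
  have : ∀ i a, ∃ κ : ℝ, i < T.last → ∀ x, T.β i a x - T.β (i + 1) a x = κ * T.h (i + 1) x := by
    intro i a
    by_cases hi : i < T.last
    · obtain ⟨κ, hκ⟩ := T.β_sub i hi a
      exact ⟨κ, fun _ => hκ⟩
    -- A dummy value: consecutive coordinates are compared only before the last swipe.
    · exact ⟨0, fun h => absurd h hi⟩
  choose κ hκ using this
  refine ⟨∑ i ∈ Finset.range T.last, ∑ a, |κ i a|, by positivity, fun k z hz => ?_⟩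
  have key : ∀ i a p, i + p ≤ T.last → |T.β (i + p) a (z (i + p)) - T.β i a (z i)| ≤
      (∑ l ∈ Finset.Ico i (i + p), |κ l a|) / k := by
    intro i a p hp
    induction p with
    | zero => simp
    | succ p ih =>
      have h1 := ih (by omega)
      have h2 := hκ (i + p) a (by omega) (z (i + p + 1))
      rw [(hz.line (i + p)).β_eq] at h2
      have h3 : |T.h (i + p + 1) (z (i + p + 1))| ≤ 1 / k :=
        abs_le.2 ⟨(hz.lower _).le, (hz.upper _).trans (by positivity)⟩
      have h4 : |T.β (i + p) a (z (i + p)) - T.β (i + p + 1) a (z (i + p + 1))| ≤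
          |κ (i + p) a| * (1 / k) := by
        rw [h2, abs_mul]; gcongr
      rw [← add_assoc, Finset.sum_Ico_succ_top (by omega), add_div]
      rw [abs_sub_comm] at h4
      calc _ ≤ |T.β (i + p + 1) a (z (i + p + 1)) - T.β (i + p) a (z (i + p))| +
            |T.β (i + p) a (z (i + p)) - T.β i a (z i)| := abs_sub_le _ _ _
        _ ≤ _ := by rw [add_comm]; refine add_le_add h1 (h4.trans (le_of_eq (by ring)))
  have key' : ∀ i j a, i ≤ j → j ≤ T.last → |T.β j a (z j) - T.β i a (z i)| ≤
      (∑ i ∈ Finset.range T.last, ∑ a, |κ i a|) / k := by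
    intro i j a hij hj
    obtain ⟨p, rfl⟩ := Nat.exists_eq_add_of_le hij
    refine (key i a p hj).trans ?_
    gcongr
    calc _ ≤ ∑ l ∈ Finset.Ico i (i + p), ∑ a, |κ l a| := Finset.sum_le_sum fun l _ =>
          Finset.single_le_sum (f := fun a => |κ l a|) (fun _ _ => abs_nonneg _) (Finset.mem_univ a)
      _ ≤ _ := Finset.sum_le_sum_of_subset_of_nonneg
          (fun l hl => by simp only [Finset.mem_Ico, Finset.mem_range] at hl ⊢; omega)
          (fun _ _ _ => by positivity)
  intro i hi j hj a
  rcases le_total i j with h | h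
  · exact key' i j a h hj
  · rw [abs_sub_comm]; exact key' j i a h hi

/-- The ranks of the ends of a path have the right sum, up to `O(1/k)`. -/
theorem exists_rk_add_rk (T : Track m) {ρ : ℝ} (hρ : ∀ a, T.rkStart a + T.rkEnd a = ρ) :
    ∃ M : ℝ, 0 ≤ M ∧ ∀ k z, T.IsTurning k z →
      |rk (z 0) + rk (z (T.last + 1)) - ρ| ≤ M / k := by
  obtain ⟨K, hK, hdrift⟩ := T.exists_drift
  -- The sum pays for the drift of the barycentric coordinates, the 2 for the heights of the first
  -- and the last turning point.
  refine ⟨∑ a, K * |T.rkEnd a| + 2, by positivity, fun k z hz => ?_⟩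
  have h1 := T.rk_eq_start (z 0)
  have h2 := T.rk_eq_end (z (T.last + 1))
  have h3 : rk (z 0) + rk (z (T.last + 1)) - ρ =
      ∑ a, (T.β T.last a (z T.last) - T.β 0 a (z 0)) * T.rkEnd a +
        (T.h 0 (z 0) + T.h (T.last + 1) (z (T.last + 1))) := by
    have h4 : ρ = ∑ a, T.β 0 a (z 0) * T.rkStart a + ∑ a, T.β 0 a (z 0) * T.rkEnd a := by
      rw [← Finset.sum_add_distrib]
      simp_rw [← mul_add, hρ, ← Finset.sum_mul, T.sum_β, one_mul]
    simp_rw [(hz.line T.last).β_eq] at h2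
    simp_rw [sub_mul, Finset.sum_sub_distrib]
    rw [h1, h2]
    linear_combination -h4
  have hh : ∀ j, |T.h j (z j)| ≤ 1 / k := fun j =>
    abs_le.2 ⟨(hz.lower _).le, (hz.upper _).trans (by positivity)⟩
  rw [h3]
  calc _ ≤ |∑ a, (T.β T.last a (z T.last) - T.β 0 a (z 0)) * T.rkEnd a| +
        |T.h 0 (z 0) + T.h (T.last + 1) (z (T.last + 1))| := abs_add_le _ _
    _ ≤ ∑ a, K / k * |T.rkEnd a| + (1 / k + 1 / k) := by
      refine add_le_add ((Finset.abs_sum_le_sum_abs _ _).trans (Finset.sum_le_sum fun a _ => ?_))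
        ((abs_add_le _ _).trans (add_le_add (hh _) (hh _)))
      rw [abs_mul]
      gcongr
      exact hdrift k z hz 0 (Nat.zero_le _) T.last le_rfl a
    _ = _ := by
      rw [add_div, Finset.sum_div]
      congr 1
      · exact Finset.sum_congr rfl fun a _ => by ring
      · ring

/-! ### Trimmed paths are disjoint symmetric chains -/

/-- The set `X` is, up to boundary points, the disjoint union of the swipes of the track. -/
structure Carries (T : Track m) (X : Set (Fin m → ℝ)) : Prop where
  cover : ∀ x ∈ X, ∃ i ≤ T.last, (∀ a, 0 ≤ T.β i a x) ∧ 0 ≤ T.h i x ∧ T.h (i + 1) x ≤ 0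
  mem : ∀ i ≤ T.last, ∀ x, T.Cell i x → (∃ l > i, T.h l x ≠ 0) → x ∈ X
  disj : ∀ i j, i < j → j ≤ T.last → ∀ x, T.Cell i x → T.Cell j x → ¬ ∃ l > j, T.h l x ≠ 0

/-- If all later heights vanished at `x`, the sequence would end at `x`, contradicting the strict
inequality of ranks. -/
theorem IsTurning.not_halted (hk : 1 ≤ k) {z : ℕ → Fin m → ℝ} (hz : T.IsTurning k z) {i : ℕ} (hi : i ≤ T.last)
    {x : Fin m → ℝ} (hl : T.Line k i (z i) x) (hx : rk x < rk (z (T.last + 1))) :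
    ∃ l > i, T.h l x ≠ 0 := by
  by_contra! hc
  rw [hz.eq_last hk hl hc (T.last + 1) (by omega)] at hx
  exact lt_irrefl _ hx

variable {X : Set (Fin m → ℝ)}

/-- Uniform bounds for the ends of the trimmed paths. -/
structure TrimBound (T : Track m) (k : ℕ) (R : ℝ) (A : ℕ) (M : ℝ) : Prop where
  one_le : 1 ≤ k
  int : ∃ n : ℤ, (k : ℝ) * R = n
  pos : 1 ≤ A
  le : ∀ z, T.IsTurning k z → |rk (z 0) + rk (z (T.last + 1)) - R| ≤ M / k
  lt : M + 1 ≤ A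

theorem TrimBound.rk_lt {R : ℝ} {A : ℕ} {M : ℝ} (hb : T.TrimBound k R A M)
    {z : ℕ → Fin m → ℝ} (hz : T.IsTurning k z) {x : Fin m → ℝ} (hx : x ∈ T.chain k R A z) :
    rk x < rk (z (T.last + 1)) := by
  have hk0 : (0 : ℝ) < k := by exact_mod_cast hb.one_le
  have h1 := (abs_le.1 (hb.le z hz)).1
  have h2 := hx.2.2
  have h3 : M / k < A / k := by gcongr; linarith [hb.lt]
  linarith

theorem chain_subset (hX : T.Carries X) {R : ℝ} {A : ℕ} {M : ℝ} (hb : T.TrimBound k R A M)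
    {z : ℕ → Fin m → ℝ} (hz : T.IsTurning k z) : T.chain k R A z ⊆ X := by
  intro x hx
  have hlt := hb.rk_lt hz hx
  obtain ⟨⟨i, hi, hl, hc⟩, -, -⟩ := hx
  exact hX.mem i hi x hc (hz.not_halted hb.one_le hi hl hlt)

/-- Trimming keeps `x` strictly below the ends of both paths, so it is not halted and can lie in
only one cell. The two paths then share a lattice line, hence a turning point. -/
theorem eq_of_mem_chain (hX : T.Carries X) {R : ℝ} {A : ℕ} {M : ℝ} (hb : T.TrimBound k R A M)
    {z z' : ℕ → Fin m → ℝ} (hz : T.IsTurning k z) (hz' : T.IsTurning k z') {x : Fin m → ℝ} (hx : x ∈ T.chain k R A z)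
    (hx' : x ∈ T.chain k R A z') : z = z' := by
  have hlt := hb.rk_lt hz hx
  have hlt' := hb.rk_lt hz' hx'
  obtain ⟨⟨i, hi, hl, hc⟩, -, -⟩ := hx
  obtain ⟨⟨j, hj, hl', hc'⟩, -, -⟩ := hx'
  have hij : i = j := by
    rcases lt_trichotomy i j with h | h | h
    · exact absurd (hz'.not_halted hb.one_le hj hl' hlt') (hX.disj i j h hj x hc hc')
    · exact h
    · exact absurd (hz.not_halted hb.one_le hi hl hlt) (hX.disj j i h hi x hc' hc)
  subst hij
  exact hz.ext hb.one_le hz' ((hl'.trans hl.symm).eq hb.one_le (hz'.lower _) (hz'.upper _)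
    (hz.lower _) (hz.upper _))

theorem IsTurning.int_rk {z : ℕ → Fin m → ℝ} (hz : T.IsTurning k z) :
    ∃ n : ℤ, (k : ℝ) * rk (z 0) = n := by
  choose n hn using hz.lat
  refine ⟨∑ i, n i, ?_⟩
  rw [rk, Finset.mul_sum, Int.cast_sum]
  exact Finset.sum_congr rfl fun i _ => hn i

theorem isSymmetricChain_chain {P : Set (Fin m → ℝ)} (hXP : X ⊆ P) (hX : T.Carries X) {A : ℕ}
    {M : ℝ} (hb : T.TrimBound k (setRank (latticePoints P k)) A M)
    {z : ℕ → Fin m → ℝ} (hz : T.IsTurning k z) (hin : T.IsInner z)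
    (hne : (T.chain k (setRank (latticePoints P k)) A z).Nonempty) :
    IsSymmetricChain (latticePoints P k) k (T.chain k (setRank (latticePoints P k)) A z) := by
  set R := setRank (latticePoints P k) with hR
  have hk := hb.one_le
  have hk0 : (0 : ℝ) < k := by exact_mod_cast hk
  obtain ⟨N, γ, hγ⟩ := hz.exists_path hk hin (T.last + 1) le_rfl
  obtain ⟨r, hr⟩ := hb.int
  obtain ⟨q, hq⟩ := hz.int_rk
  -- the path is trimmed to the indices from `A` to `H`
  set H : ℤ := r - 2 * q - A with hH
  have hrank : ∀ n ≤ N, (rk (z 0) + (A : ℝ) / k ≤ rk (γ n) ∧ rk (γ n) ≤ R - rk (z 0) - (A : ℝ) / k) ↔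
      A ≤ n ∧ (n : ℤ) ≤ H := by
    intro n hn
    rw [hγ.rk_eq hn]
    have h1 : (n : ℤ) ≤ H ↔ (n : ℝ) ≤ k * R - 2 * (k * rk (z 0)) - A := by
      rw [hr, hq, hH]
      exact_mod_cast Iff.rfl
    have h2 : A ≤ n ↔ (A : ℝ) / k ≤ n / k := by
      rw [div_le_div_iff_of_pos_right hk0, Nat.cast_le]
    have h3 : k * R - 2 * (k * rk (z 0)) - A = (R - rk (z 0) - A / k - rk (z 0)) * k := by
      field_simp; ring
    rw [h1, h2, h3, ← div_le_iff₀ hk0]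
    constructor
    · rintro ⟨h4, h5⟩; constructor <;> linarith
    · rintro ⟨h4, h5⟩; constructor <;> linarith
  have hmem : ∀ x, x ∈ T.chain k R A z ↔ ∃ n ≤ N, A ≤ n ∧ (n : ℤ) ≤ H ∧ γ n = x := by
    intro x
    constructor
    · rintro ⟨⟨i, hi, hl, hc⟩, h1⟩
      obtain ⟨n, hn, rfl⟩ := hγ.surj i (by omega) x hl hc
      obtain ⟨h2, h3⟩ := (hrank (n + 1) hn).1 h1
      exact ⟨n + 1, hn, h2, h3, rfl⟩
    · rintro ⟨n, hn, h1, h2, rfl⟩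
      refine ⟨?_, (hrank n hn).2 ⟨h1, h2⟩⟩
      -- Since `A ≥ 1`, the initial point of the path, which need not lie in a cell, is trimmed off.
      obtain ⟨n, rfl⟩ := Nat.exists_eq_succ_of_ne_zero (n := n) (by have := hb.pos; omega)
      obtain ⟨i, hi, h3, h4, -⟩ := hγ.step n hn
      exact ⟨i, by omega, h3, h4⟩
  -- The error `M / k` in the sum of the end ranks is less than `A / k`, so the upper cut falls
  -- within the path.
  have hHN : H ≤ N := by
    have h1 := (abs_le.1 (hb.le z hz)).1
    rw [← hγ.last, hγ.rk_eq le_rfl] at h1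
    have h3 : M / k ≤ A / k := by gcongr; linarith [hb.lt]
    have h4 : R - rk (z 0) - A / k - rk (z 0) ≤ N / k := by linarith
    rw [le_div_iff₀ hk0] at h4
    have h5 : (H : ℝ) = (R - rk (z 0) - A / k - rk (z 0)) * k := by
      rw [hH]; push_cast; rw [← hr, ← hq]; field_simp; ring
    rw [← h5] at h4
    exact_mod_cast h4
  obtain ⟨x, hx⟩ := hne
  obtain ⟨n, -, hn1, hn2, -⟩ := (hmem x).1 hx
  obtain ⟨L, hL⟩ : ∃ L : ℕ, H = A + L := ⟨(H - A).toNat, by omega⟩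
  have hstep : ∀ j < L, ∃ i, γ (A + j + 1) = γ (A + j) + (1 / k : ℝ) • Pi.single i (1 : ℝ) := by
    intro j hj
    obtain ⟨i, -, -, -, e⟩ := hγ.step (A + j) (by omega)
    exact ⟨_, e⟩
  refine ⟨L, fun j => γ (A + j), fun j => ?_, fun j => ?_, ?_, ?_⟩
  · have hj := j.2
    have hc : γ (A + j) ∈ T.chain k R A z :=
      (hmem _).2 ⟨A + j, by omega, by omega, by push_cast; omega, rfl⟩
    refine ⟨hXP (chain_subset hX hb hz hc), ?_⟩
    obtain ⟨⟨i, hi, hl, -⟩, -, -⟩ := hc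
    have hlat : ∀ i l, ∃ n : ℤ, (k : ℝ) * z i l = n := by
      intro i
      induction i with
      | zero => exact hz.lat
      | succ i ih => exact (hz.line i).lat hk ih
    exact hl.lat hk (hlat i)
  · obtain ⟨i, e⟩ := hstep j j.2
    simp only [Fin.val_castSucc, Fin.val_succ, ← add_assoc]
    refine ⟨?_, by rw [e, rk_add_smul_single]⟩
    rw [e]
    refine le_add_of_nonneg_right (smul_nonneg (by positivity) ?_)
    simp [Pi.single_nonneg]
  · simp only [Fin.val_zero, Fin.val_last, add_zero]
    rw [hγ.rk_eq (by omega), hγ.rk_eq (by omega), ← hR]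
    have h5 : ((A + L : ℕ) : ℝ) = k * R - 2 * (k * rk (z 0)) - A := by
      rw [hr, hq]
      have : ((A + L : ℕ) : ℤ) = r - 2 * q - A := by push_cast; omega
      exact_mod_cast this
    rw [h5]; field_simp; ring
  · ext x
    rw [hmem]
    constructor
    · rintro ⟨n, hn, h1, h2, rfl⟩
      exact ⟨⟨n - A, by omega⟩, by simp only; congr 1; omega⟩
    · rintro ⟨j, rfl⟩
      have := j.2
      exact ⟨A + j, by omega, by omega, by push_cast; omega, rfl⟩

/-! ### Points missed by the trimmed paths -/

theorem h_linear_ne (T : Track m) (j : ℕ) : (T.h j).linear ≠ 0 := by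
  intro h
  have := T.h_dir j
  rw [h] at this
  simp at this

/-- A barycentric coordinate can be constant, as when the turning sets are single points. It is then
1, and the strip is empty for large `k`. -/
theorem negligible_β {P : Set (Fin m → ℝ)} {B : ℕ} (hB : ∀ x ∈ P, ∀ i, |x i| ≤ B) (T : Track m)
    (i : ℕ) (a : Fin (T.d + 1)) (C : ℝ) : Negligible P (fun k => {x | |T.β i a x| ≤ C / k}) := by
  by_cases h : (T.β i a).linear = 0
  · obtain ⟨K₀, hK₀⟩ := exists_nat_gt |C|
    refine negligible_of_eventually K₀ fun k hk => eq_empty_of_forall_notMem fun x hx => ?_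
    have hk' : |C| < k := hK₀.trans_le (by exact_mod_cast hk)
    have hk0 : (0 : ℝ) < k := (abs_nonneg C).trans_lt hk'
    rw [mem_ofPred_eq, T.β_eq_one i a h, abs_one, le_div_iff₀ hk0, one_mul] at hx
    linarith [le_abs_self C]
  · exact negligible_strip hB _ h C

/-- The points of a snake that are on none of the trimmed paths are near finitely many
hyperplanes. -/
theorem exists_strips (T : Track m) (hX : T.Carries X) (A : ℕ) (M : ℝ) : ∃ C : ℝ, ∀ k R,
    T.TrimBound k R A M → ∀ x ∈ X, (∀ l, ∃ n : ℤ, (k : ℝ) * x l = n) →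
    (∀ z, T.IsTurning k z → T.IsInner z → x ∉ T.chain k R A z) →
    (∃ j ≤ T.last + 1, |T.h j x| ≤ C / k) ∨ ∃ i ≤ T.last, ∃ a, |T.β i a x| ≤ C / k := by
  obtain ⟨K, hK, hdrift⟩ := T.exists_drift
  set L : ℕ → ℝ := fun j => ∑ i, |(T.h j).linear (Pi.single i 1)| with hL
  have hL0 : ∀ j, 0 ≤ L j := fun j => Finset.sum_nonneg fun _ _ => abs_nonneg _
  -- `K` covers the drift away from the side walls, the terms with `L` bound the change of height
  -- over the steps trimmed at the start and at the end, and 1 covers the height of an end point.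
  refine ⟨K + L 0 * A + L (T.last + 1) * (|M| + A) + 1, fun k R hb x hx hlat hnot => ?_⟩
  have hk := hb.one_le
  have hk0 : (0 : ℝ) < k := by exact_mod_cast hk
  set C := K + L 0 * A + L (T.last + 1) * (|M| + A) + 1 with hC
  have hp1 := mul_nonneg (hL0 0) (Nat.cast_nonneg (α := ℝ) A)
  have hp2 := mul_nonneg (hL0 (T.last + 1)) (by positivity : 0 ≤ |M| + (A : ℝ))
  by_contra! hc
  obtain ⟨hc1, hc2⟩ := hc
  obtain ⟨i, hi, hβ, h1, h2⟩ := hX.cover x hx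
  have hC0 : 0 ≤ C / k := by positivity
  have hβ' : ∀ a, C / k < T.β i a x := fun a => by
    have := hc2 i hi a
    rwa [abs_of_nonneg (hβ a)] at this
  have hcell : T.Cell i x := by
    refine ⟨fun a => hC0.trans_lt (hβ' a), ?_, h2⟩
    have := hc1 i (by omega)
    rw [abs_of_nonneg h1] at this
    exact hC0.trans_lt this
  obtain ⟨z, hz, hline⟩ := T.exists_turning_through hk i x hlat
  have hin : T.IsInner z := by
    intro j hj a
    have h3 := (abs_le.1 (hdrift k z hz i hi j hj a)).1
    have h4 := hβ' a
    rw [hline.β_eq] at h4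
    have h5 : K / k ≤ C / k := by gcongr; linarith
    linarith
  obtain ⟨N, γ, hγ⟩ := hz.exists_path hk hin (T.last + 1) le_rfl
  obtain ⟨n, hn, rfl⟩ := hγ.surj i (by omega) x hline hcell
  have hh : ∀ j, |T.h j (z j)| ≤ 1 / k := fun j =>
    abs_le.2 ⟨(hz.lower _).le, (hz.upper _).trans (by positivity)⟩
  refine hnot z hz hin ⟨⟨i, hi, hline, hcell⟩, ?_, ?_⟩
  · by_contra! hlt
    rw [hγ.rk_eq hn] at hlt
    have h3 : ((n + 1 : ℕ) : ℝ) < A := (div_lt_div_iff_of_pos_right hk0).1 (by linarith)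
    have h4 := hγ.abs_sub_le (T.h 0) (n := 0) (p := n + 1) (by omega)
    rw [zero_add, hγ.zero] at h4
    have h5 : |T.h 0 (γ (n + 1))| ≤ L 0 * A / k + 1 / k := by
      calc _ = |(T.h 0 (γ (n + 1)) - T.h 0 (z 0)) + T.h 0 (z 0)| := by rw [sub_add_cancel]
        _ ≤ _ := (abs_add_le _ _).trans (add_le_add (h4.trans ?_) (hh 0))
      have := hL0 0
      gcongr
    have h6 : L 0 * A / k + 1 / k ≤ C / k := by rw [← add_div]; gcongr; linarith
    exact absurd (h5.trans h6) (not_le.2 (hc1 0 (by omega)))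
  · by_contra! hlt
    have h3 := (abs_le.1 (hb.le z hz)).2
    rw [← hγ.last, hγ.rk_eq le_rfl] at h3
    rw [hγ.rk_eq hn] at hlt
    obtain ⟨p, hp⟩ := Nat.exists_eq_add_of_le hn
    have h4 := hγ.abs_sub_le (T.h (T.last + 1)) (n := n + 1) (p := p) (by omega)
    rw [← hp, hγ.last] at h4
    have hp' : (p : ℝ) ≤ |M| + A := by
      have e : (N : ℝ) / k = ((n + 1 : ℕ) : ℝ) / k + p / k := by rw [← add_div, ← Nat.cast_add, ← hp]
      have h5 : (p : ℝ) / k < M / k + A / k := by linarith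
      rw [← add_div, div_lt_div_iff_of_pos_right hk0] at h5
      linarith [le_abs_self M]
    have h5 : |T.h (T.last + 1) (γ (n + 1))| ≤ L (T.last + 1) * (|M| + A) / k + 1 / k := by
      rw [abs_sub_comm] at h4
      calc _ = |(T.h (T.last + 1) (γ (n + 1)) - T.h (T.last + 1) (z (T.last + 1))) +
            T.h (T.last + 1) (z (T.last + 1))| := by rw [sub_add_cancel]
        _ ≤ _ := (abs_add_le _ _).trans (add_le_add (h4.trans ?_) (hh _))
      have := hL0 (T.last + 1)
      gcongr
    have h6 : L (T.last + 1) * (|M| + A) / k + 1 / k ≤ C / k := by rw [← add_div]; gcongr; linarith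
    exact absurd (h5.trans h6) (not_le.2 (hc1 _ le_rfl))

/-- A snake carried by a track consists of disjoint symmetric chains, up to few points. -/
theorem exists_chains {P : Set (Fin m → ℝ)} (hP : IsFullDimPolytope P) (T : Track m)
    (hXP : X ⊆ P) (hX : T.Carries X) (hρ : ∀ a, T.rkStart a + T.rkEnd a = setRank P) :
    ∃ (K₀ : ℕ) (𝒞 : ℕ → Set (Set (Fin m → ℝ))),
      (∀ k ≥ K₀, (∀ c ∈ 𝒞 k, IsSymmetricChain (latticePoints P k) k c ∧ c ⊆ X) ∧
        (𝒞 k).PairwiseDisjoint id) ∧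
      Negligible P (fun k => {x | K₀ ≤ k ∧ x ∈ X ∧ x ∉ ⋃₀ 𝒞 k}) := by
  obtain ⟨B, hB⟩ := hP.bounded
  obtain ⟨K₀, K, hK₀, hrank⟩ := exists_setRank_latticePoints hP
  obtain ⟨M, hM, hends⟩ := T.exists_rk_add_rk hρ
  -- `M` bounds the asymmetry of a path relative to `P`, and `K` the discrepancy between the ranks
  -- of `P(k)` and `P`.
  set A : ℕ := ⌈M + K⌉₊ + 1 with hA
  have hbound : ∀ k ≥ K₀, T.TrimBound k (setRank (latticePoints P k)) A (M + K) := by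
    intro k hk
    refine ⟨by omega, (hrank k hk).2, by omega, fun z hz => ?_, ?_⟩
    · have h1 := hends k z hz
      have h2 := (hrank k hk).1
      rw [abs_sub_comm] at h2
      rw [add_div]
      exact (abs_sub_le _ (setRank P) _).trans (add_le_add h1 h2)
    · rw [hA]; push_cast; linarith [Nat.le_ceil (M + K)]
  obtain ⟨C, hC⟩ := T.exists_strips hX A (M + K)
  refine ⟨K₀, fun k => {c | ∃ z, T.IsTurning k z ∧ T.IsInner z ∧
    c = T.chain k (setRank (latticePoints P k)) A z ∧ c.Nonempty}, fun k hk => ⟨?_, ?_⟩, ?_⟩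
  · rintro _ ⟨z, hz, hin, rfl, hne⟩
    exact ⟨isSymmetricChain_chain hXP hX (hbound k hk) hz hin hne,
      chain_subset hX (hbound k hk) hz⟩
  · rintro _ ⟨z, hz, -, rfl, -⟩ _ ⟨z', hz', -, rfl, -⟩ hne
    refine Set.disjoint_left.2 fun x hx hx' => hne ?_
    rw [eq_of_mem_chain hX (hbound k hk) hz hz' hx hx']
  · have h1 : Negligible P (fun k => ⋃ j : Fin (T.last + 2), {x | |T.h j x| ≤ C / k}) :=
      Negligible.iUnion fun j => negligible_strip hB _ (T.h_linear_ne j) C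
    have h2 : Negligible P (fun k => ⋃ i : Fin (T.last + 1), ⋃ a, {x | |T.β i a x| ≤ C / k}) :=
      Negligible.iUnion fun i => Negligible.iUnion fun a => T.negligible_β hB i a C
    refine (h1.union h2).mono hB fun k _ x hx => ?_
    obtain ⟨⟨hk, hxX, hnot⟩, hlat⟩ := hx
    rcases hC k _ (hbound k hk) x hxX hlat.2 (fun z hz hin hc =>
      hnot ⟨_, ⟨z, hz, hin, rfl, ⟨x, hc⟩⟩, hc⟩) with ⟨j, hj, h⟩ | ⟨i, hi, a, h⟩
    · exact Or.inl (mem_iUnion.2 ⟨⟨j, by omega⟩, h⟩)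
    · exact Or.inr (mem_iUnion.2 ⟨⟨i, by omega⟩, mem_iUnion.2 ⟨a, h⟩⟩)

end Track

/-! ### Affine coordinates adapted to a simplex and a transversal direction -/

/-- The point with coordinates `w`, `t` with respect to the vertices `v` and the direction `e`. -/
def coordPoint {m d : ℕ} (v : Fin (d + 1) → Fin m → ℝ) (e : Fin m → ℝ) (w : Fin (d + 1) → ℝ)
    (t : ℝ) : Fin m → ℝ := ∑ a, w a • v a + t • e

theorem mem_convexHull_range {m d : ℕ} {v : Fin (d + 1) → Fin m → ℝ} {x : Fin m → ℝ} :
    x ∈ convexHull ℝ (range v) ↔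
      ∃ w : Fin (d + 1) → ℝ, (∀ a, 0 ≤ w a) ∧ ∑ a, w a = 1 ∧ x = ∑ a, w a • v a := by
  constructor
  · intro hx
    have : convexHull ℝ (range v) ⊆ {x | ∃ w : Fin (d + 1) → ℝ, (∀ a, 0 ≤ w a) ∧ ∑ a, w a = 1 ∧
        x = ∑ a, w a • v a} := by
      refine convexHull_min ?_ ?_
      · rintro _ ⟨a, rfl⟩
        exact ⟨Pi.single a 1, fun b => by
          rcases eq_or_ne b a with rfl | h <;> simp [*], by simp, by simp [Pi.single_apply]⟩
      · rintro _ ⟨w, hw, hw1, rfl⟩ _ ⟨w', hw', hw1', rfl⟩ p q hp hq hpq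
        refine ⟨p • w + q • w', fun a => ?_, ?_, ?_⟩
        · exact add_nonneg (mul_nonneg hp (hw a)) (mul_nonneg hq (hw' a))
        · simp [Finset.sum_add_distrib, ← Finset.mul_sum, hw1, hw1', hpq]
        · simp [Finset.smul_sum, add_smul, Finset.sum_add_distrib, mul_smul]
    exact this hx
  · rintro ⟨w, hw, hw1, rfl⟩
    exact (convex_convexHull ℝ _).sum_mem (fun a _ => hw a) hw1
      fun a _ => subset_convexHull ℝ _ (mem_range_self a)

theorem coordPoint_injective {m d : ℕ} {v : Fin (d + 1) → Fin m → ℝ} {e : Fin m → ℝ}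
    (hv : AffineIndependent ℝ v) (he : e ∉ vectorSpan ℝ (range v)) {w : Fin (d + 1) → ℝ} {t : ℝ}
    (hw : ∑ a, w a = 0) (h : coordPoint v e w t = 0) : w = 0 ∧ t = 0 := by
  have ht : t = 0 := by
    by_contra ht
    refine he ?_
    have h1 : ∑ a, w a • v a ∈ vectorSpan ℝ (range v) := by
      rw [← Finset.univ.weightedVSub_eq_linear_combination hw]
      exact weightedVSub_mem_vectorSpan hw v
    have h2 : e = (-t⁻¹) • ∑ a, w a • v a := by
      rw [eq_neg_of_add_eq_zero_left h, neg_smul, smul_neg, neg_neg, smul_smul,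
        inv_mul_cancel₀ ht, one_smul]
    rw [h2]
    exact Submodule.smul_mem _ _ h1
  refine ⟨?_, ht⟩
  subst ht
  rw [coordPoint, zero_smul, add_zero] at h
  ext a
  exact affineIndependent_iff.1 hv Finset.univ w hw h a (Finset.mem_univ a)

/-- Homogenising by the sum of the weights turns the coordinate map into an injective linear map
between spaces of equal dimension; its inverse, restricted to the slice where the sum is 1, gives
the affine coordinates. -/
theorem exists_affine_coords {m d : ℕ} (hd : d + 1 = m) {v : Fin (d + 1) → Fin m → ℝ}
    {e : Fin m → ℝ} (hv : AffineIndependent ℝ v) (he : e ∉ vectorSpan ℝ (range v)) :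
    ∃ (β : Fin (d + 1) → (Fin m → ℝ) →ᵃ[ℝ] ℝ) (h : (Fin m → ℝ) →ᵃ[ℝ] ℝ),
      (∀ x, ∑ a, β a x = 1 ∧ coordPoint v e (fun a => β a x) (h x) = x) ∧
      (∀ w t, ∑ a, w a = 1 → (∀ a, β a (coordPoint v e w t) = w a) ∧ h (coordPoint v e w t) = t) := by
  let Φ : ((Fin (d + 1) → ℝ) × ℝ) →ₗ[ℝ] ((Fin m → ℝ) × ℝ) :=
    { toFun := fun p => (coordPoint v e p.1 p.2, ∑ a, p.1 a)
      map_add' := fun p q => by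
        ext1
        · simp only [coordPoint, Prod.fst_add, Prod.snd_add, Pi.add_apply, add_smul,
            Finset.sum_add_distrib]
          abel
        · simp [Finset.sum_add_distrib]
      map_smul' := fun c p => by
        ext1
        · simp [coordPoint, mul_smul, Finset.smul_sum]
        · simp [Finset.mul_sum] }
  have hinj : Function.Injective Φ := by
    rw [← LinearMap.ker_eq_bot, LinearMap.ker_eq_bot']
    rintro ⟨w, t⟩ h
    obtain ⟨h1, h2⟩ := Prod.ext_iff.1 h
    obtain ⟨rfl, rfl⟩ := coordPoint_injective hv he (w := w) (t := t) h2 h1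
    rfl
  have hdim : Module.finrank ℝ ((Fin (d + 1) → ℝ) × ℝ) = Module.finrank ℝ ((Fin m → ℝ) × ℝ) := by
    simp [hd]
  let Ψ := LinearMap.linearEquivOfInjective Φ hinj hdim
  have hΨ : ∀ p, Ψ p = Φ p := fun p => rfl
  let ι : (Fin m → ℝ) →ᵃ[ℝ] ((Fin m → ℝ) × ℝ) :=
    (AffineMap.id ℝ (Fin m → ℝ)).prod (AffineMap.const ℝ _ 1)
  have hι : ∀ x, ι x = (x, 1) := fun x => rfl
  refine ⟨fun a => (LinearMap.proj a ∘ₗ LinearMap.fst ℝ _ _ ∘ₗ Ψ.symm.toLinearMap).toAffineMap.comp ι,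
    (LinearMap.snd ℝ _ _ ∘ₗ Ψ.symm.toLinearMap).toAffineMap.comp ι, fun x => ?_, fun w t hw => ?_⟩
  · have h := Ψ.apply_symm_apply (x, 1)
    rw [hΨ] at h
    obtain ⟨h1, h2⟩ := Prod.ext_iff.1 h
    exact ⟨h2, h1⟩
  · have h : Ψ.symm (ι (coordPoint v e w t)) = (w, t) := by
      rw [LinearEquiv.symm_apply_eq, hι, hΨ]
      exact Prod.ext rfl hw.symm
    constructor
    · intro a
      change (Ψ.symm (ι (coordPoint v e w t))).1 a = w a
      rw [h]
    · change (Ψ.symm (ι (coordPoint v e w t))).2 = t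
      rw [h]

theorem exists_affine_sum {m : ℕ} {ι : Type*} (s : Finset ι) (t : ι → ℝ)
    (f : ι → (Fin m → ℝ) →ᵃ[ℝ] ℝ) : ∃ g : (Fin m → ℝ) →ᵃ[ℝ] ℝ, ∀ x, g x = ∑ a ∈ s, t a * f a x := by
  classical
  induction s using Finset.induction_on with
  | empty => exact ⟨0, fun x => by simp⟩
  | insert a s ha ih =>
    obtain ⟨g, hg⟩ := ih
    exact ⟨t a • f a + g, fun x => by simp [Finset.sum_insert ha, hg]⟩

theorem rk_coordPoint {m d : ℕ} (v : Fin (d + 1) → Fin m → ℝ) (i : Fin m) (w : Fin (d + 1) → ℝ)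
    (t : ℝ) : rk (coordPoint v (Pi.single i 1) w t) = ∑ a, w a * rk (v a) + t := by
  rw [coordPoint, rk_add_smul_single]
  congr 1
  simp only [rk, Finset.sum_apply, Pi.smul_apply, smul_eq_mul, Finset.mul_sum]
  exact Finset.sum_comm

theorem coordPoint_add {m d : ℕ} (v : Fin (d + 1) → Fin m → ℝ) (e : Fin m → ℝ)
    (w : Fin (d + 1) → ℝ) (t s : ℝ) :
    coordPoint v e w (t + s) = coordPoint v e w t + s • e := by
  simp only [coordPoint]; module

theorem mem_partialSimplex {m d : ℕ} {v : Fin (d + 1) → Fin m → ℝ} (hv : AffineIndependent ℝ v)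
    {R : Set (Finset (Fin (d + 1)))} (hR : Finset.univ ∉ R) {w : Fin (d + 1) → ℝ}
    (hw : ∀ a, 0 < w a) (hw1 : ∑ a, w a = 1) : ∑ a, w a • v a ∈ partialSimplex v R := by
  refine ⟨mem_convexHull_range.2 ⟨w, fun a => (hw a).le, hw1, rfl⟩, fun h => ?_⟩
  obtain ⟨F, hF, w', hw', hw0', hw1', hs⟩ := mem_iUnion₂.1 h
  have hFne : F ≠ Finset.univ := fun h => hR (h ▸ hF)
  obtain ⟨a, ha⟩ : ∃ a, a ∉ F := by
    by_contra! hall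
    exact hFne (Finset.eq_univ_iff_forall.2 hall)
  have hsum : ∑ a, (w a - w' a) = 0 := by rw [Finset.sum_sub_distrib, hw1, hw1', sub_self]
  have hz : ∑ a, (w a - w' a) • v a = 0 := by
    simp_rw [sub_smul, Finset.sum_sub_distrib]
    rw [hs, sub_self]
  have := affineIndependent_iff.1 hv Finset.univ _ hsum hz a (Finset.mem_univ a)
  rw [hw0' a ha, sub_zero] at this
  exact (hw a).ne' this

/-- An affine equation that holds on a partial simplex holds at its vertices. -/
theorem eq_vertex_of_eq_partialSimplex {m d : ℕ} {v : Fin (d + 1) → Fin m → ℝ}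
    (hv : AffineIndependent ℝ v) {R : Set (Finset (Fin (d + 1)))} (hR : Finset.univ ∉ R)
    {c : Fin m → ℝ} {b : ℝ} (h : ∀ x ∈ partialSimplex v R, ∑ l, c l * x l = b) (a : Fin (d + 1)) :
    ∑ l, c l * v a l = b := by
  -- Only positive weights are sure to give points of the partial simplex. Subtracting the relation
  -- for all weights 1 from the one with weight 2 at `a` isolates the vertex `a`.
  have hom : ∀ w : Fin (d + 1) → ℝ, (∀ a, 0 < w a) → ∑ a, w a * (∑ l, c l * v a l - b) = 0 := by
    intro w hw
    set s := ∑ a, w a with hs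
    have hs0 : 0 < s := Finset.sum_pos (fun a _ => hw a) Finset.univ_nonempty
    have h1 := h _ (mem_partialSimplex hv hR (w := fun a => w a / s) (fun a => div_pos (hw a) hs0)
      (by rw [← Finset.sum_div, ← hs, div_self hs0.ne']))
    have h2 : ∑ l, c l * (∑ a, (w a / s) • v a) l = (∑ a, w a * ∑ l, c l * v a l) / s := by
      simp only [Finset.sum_apply, Pi.smul_apply, smul_eq_mul, Finset.mul_sum, Finset.sum_div]
      rw [Finset.sum_comm]
      exact Finset.sum_congr rfl fun a _ => Finset.sum_congr rfl fun l _ => by ring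
    rw [h2, div_eq_iff hs0.ne'] at h1
    simp_rw [mul_sub, Finset.sum_sub_distrib, ← Finset.sum_mul, ← hs]
    rw [h1]; ring
  have h1 := hom (fun _ => 1) (fun _ => one_pos)
  have h2 := hom (fun a' => 1 + if a' = a then 1 else 0) (fun a' => by positivity)
  simp only [add_mul, Finset.sum_add_distrib, ite_mul, one_mul, zero_mul, Finset.sum_ite_eq',
    Finset.mem_univ, if_true] at h2
  simp only [one_mul] at h1
  linarith

/-! ### The track of a sequence of swipes -/

namespace SwipeSeq

variable {m : ℕ} (S : SwipeSeq m)

/-- Affine coordinates of a swipe: the barycentric coordinates of the projections to its starting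
and to its ending set, and the heights above these sets. -/
structure Coords (i : Fin (S.last + 1)) where
  β : Fin (S.d + 1) → (Fin m → ℝ) →ᵃ[ℝ] ℝ
  hs : (Fin m → ℝ) →ᵃ[ℝ] ℝ
  he : (Fin m → ℝ) →ᵃ[ℝ] ℝ
  sum_β : ∀ x, ∑ a, β a x = 1
  start : ∀ x, coordPoint (S.vertex i.castSucc) (Pi.single (S.dir i) 1) (fun a => β a x) (hs x) = x
  fin : ∀ x, coordPoint (S.vertex i.succ) (Pi.single (S.dir i) 1) (fun a => β a x) (he x) = x
  start_unique : ∀ w t, ∑ a, w a = 1 →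
    (∀ a, β a (coordPoint (S.vertex i.castSucc) (Pi.single (S.dir i) 1) w t) = w a) ∧
    hs (coordPoint (S.vertex i.castSucc) (Pi.single (S.dir i) 1) w t) = t
  fin_unique : ∀ w t, ∑ a, w a = 1 →
    (∀ a, β a (coordPoint (S.vertex i.succ) (Pi.single (S.dir i) 1) w t) = w a) ∧
    he (coordPoint (S.vertex i.succ) (Pi.single (S.dir i) 1) w t) = t
  le : ∀ x, (∀ a, 0 ≤ β a x) → he x ≤ hs x

theorem nonempty_coords (hd : S.d + 1 = m) (i : Fin (S.last + 1)) : Nonempty (S.Coords i) := by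
  obtain ⟨β, hs, h1, h2⟩ := exists_affine_coords hd (S.indep i.castSucc) (S.transversal i)
  choose t ht0 ht using S.translate i
  obtain ⟨g, hg⟩ := exists_affine_sum Finset.univ t β
  -- The vertex `a` is translated by `t a`, so the point with weights `w` is translated by `∑ a, t a
  -- * w a`. Both turning sets thus share barycentric coordinates, and the two heights differ by
  -- this sum.
  have key : ∀ w s, coordPoint (S.vertex i.succ) (Pi.single (S.dir i) 1) w s =
      coordPoint (S.vertex i.castSucc) (Pi.single (S.dir i) 1) w (s + ∑ a, t a * w a) := by
    intro w s
    simp only [coordPoint, ht, smul_add, Finset.sum_add_distrib, add_smul, Finset.sum_smul, smul_smul]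
    simp only [mul_comm (w _) (t _)]
    abel
  refine ⟨⟨β, hs, hs - g, fun x => (h1 x).1, fun x => (h1 x).2, fun x => ?_, h2, fun w s hw => ?_,
    fun x hx => ?_⟩⟩
  · rw [key]
    convert (h1 x).2 using 2
    simp [hg]
  · rw [key]
    obtain ⟨h3, h4⟩ := h2 w (s + ∑ a, t a * w a) hw
    refine ⟨h3, ?_⟩
    change hs _ - g _ = s
    rw [h4, hg]
    simp only [h3]
    ring
  · change hs x - g x ≤ hs x
    rw [hg, sub_le_self_iff]
    exact Finset.sum_nonneg fun a _ => mul_nonneg (ht0 a) (hx a)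

namespace Coords

variable {S} {i : Fin (S.last + 1)} (c : S.Coords i)

theorem linear_dir (f : (Fin m → ℝ) →ᵃ[ℝ] ℝ) (e : Fin m → ℝ) {v : Fin (S.d + 1) → Fin m → ℝ}
    {w : Fin (S.d + 1) → ℝ} :
    f.linear e = f (coordPoint v e w 1) - f (coordPoint v e w 0) := by
  rw [← zero_add (1 : ℝ), coordPoint_add, one_smul, AffineMap.map_add_linear, add_sub_cancel_left]

theorem hs_dir : c.hs.linear (Pi.single (S.dir i) 1) = 1 := by
  have h : ∑ a, (Pi.single 0 1 : Fin (S.d + 1) → ℝ) a = 1 := by simp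
  rw [linear_dir c.hs _ (v := S.vertex i.castSucc) (w := Pi.single 0 1), (c.start_unique _ _ h).2,
    (c.start_unique _ _ h).2, sub_zero]

theorem he_dir : c.he.linear (Pi.single (S.dir i) 1) = 1 := by
  have h : ∑ a, (Pi.single 0 1 : Fin (S.d + 1) → ℝ) a = 1 := by simp
  rw [linear_dir c.he _ (v := S.vertex i.succ) (w := Pi.single 0 1), (c.fin_unique _ _ h).2,
    (c.fin_unique _ _ h).2, sub_zero]

theorem β_dir (a) : (c.β a).linear (Pi.single (S.dir i) 1) = 0 := by
  have h : ∑ a, (Pi.single 0 1 : Fin (S.d + 1) → ℝ) a = 1 := by simp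
  rw [linear_dir (c.β a) _ (v := S.vertex i.castSucc) (w := Pi.single 0 1),
    (c.start_unique _ _ h).1, (c.start_unique _ _ h).1, sub_self]

/-- A constant barycentric coordinate takes the value it has at its own vertex. -/
theorem β_eq_one (a) (h : (c.β a).linear = 0) (x : Fin m → ℝ) : c.β a x = 1 := by
  have h1 : ∑ b, (Pi.single a 1 : Fin (S.d + 1) → ℝ) b = 1 := by simp
  have h2 := (c.start_unique _ 0 h1).1 a
  set y := coordPoint (S.vertex i.castSucc) (Pi.single (S.dir i) 1) (Pi.single a 1) 0
  have h3 := AffineMap.map_add_linear (c.β a) y (x - y)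
  rw [h, add_sub_cancel] at h3
  simpa [h2] using h3

theorem exists_of_mem_turning {j : Fin (S.last + 1 + 1)} {x : Fin m → ℝ} (hx : x ∈ S.turningSet j)
    (e : Fin m → ℝ) :
    ∃ w : Fin (S.d + 1) → ℝ, (∀ a, 0 ≤ w a) ∧ ∑ a, w a = 1 ∧ x = coordPoint (S.vertex j) e w 0 := by
  obtain ⟨w, h1, h2, h3⟩ := mem_convexHull_range.1 hx.1
  exact ⟨w, h1, h2, by rw [h3, coordPoint, zero_smul, add_zero]⟩

theorem hs_eq_zero {x : Fin m → ℝ} (hx : x ∈ S.startSet i) : c.hs x = 0 := by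
  obtain ⟨w, -, h2, rfl⟩ := exists_of_mem_turning hx (Pi.single (S.dir i) 1)
  exact (c.start_unique w 0 h2).2

theorem he_eq_zero {x : Fin m → ℝ} (hx : x ∈ S.endSet i) : c.he x = 0 := by
  obtain ⟨w, -, h2, rfl⟩ := exists_of_mem_turning hx (Pi.single (S.dir i) 1)
  exact (c.fin_unique w 0 h2).2

theorem of_mem_swipe {x : Fin m → ℝ} (hx : x ∈ S.swipe i) :
    (∀ a, 0 ≤ c.β a x) ∧ 0 ≤ c.hs x ∧ c.he x ≤ 0 := by
  obtain ⟨y, hy, y', hy', ⟨t, ht, e⟩, p, q, hp, hq, hpq, rfl⟩ := hx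
  obtain ⟨w, hw, hw1, h1⟩ := exists_of_mem_turning hy (Pi.single (S.dir i) 1)
  obtain ⟨w', -, hw1', h2⟩ := exists_of_mem_turning hy' (Pi.single (S.dir i) 1)
  have e1 : p • y + q • y' =
      coordPoint (S.vertex i.castSucc) (Pi.single (S.dir i) 1) w (0 + q * t) := by
    rw [coordPoint_add, ← h1, e]
    obtain rfl : p = 1 - q := by linarith
    module
  have e2 : p • y + q • y' =
      coordPoint (S.vertex i.succ) (Pi.single (S.dir i) 1) w' (0 + -(p * t)) := by
    have h3 : y = y' - t • Pi.single (S.dir i) (1 : ℝ) := by rw [e, add_sub_cancel_right]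
    rw [coordPoint_add, ← h2, h3]
    obtain rfl : q = 1 - p := by linarith
    module
  refine ⟨fun a => ?_, ?_, ?_⟩
  · rw [e1, (c.start_unique w _ hw1).1]; exact hw a
  · rw [e1, (c.start_unique w _ hw1).2]; positivity
  · rw [e2, (c.fin_unique w' _ hw1').2]
    have : 0 ≤ p * t := by positivity
    linarith

theorem mem_swipe {x : Fin m → ℝ} (hβ : ∀ a, 0 < c.β a x) (h1 : 0 ≤ c.hs x) (h2 : c.he x ≤ 0) :
    x ∈ S.swipe i := by
  set e : Fin m → ℝ := Pi.single (S.dir i) 1 with he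
  have e1 := c.start x
  have e2 := c.fin x
  simp only [coordPoint, ← he] at e1 e2
  set y := ∑ a, c.β a x • S.vertex i.castSucc a
  set y' := ∑ a, c.β a x • S.vertex i.succ a
  have e3 : y' = y + (c.hs x - c.he x) • e := by
    rw [sub_smul, ← add_sub_assoc, e1]
    exact eq_sub_of_add_eq e2
  refine ⟨y, mem_partialSimplex (S.indep _) S.univ_notMem hβ (c.sum_β x), y',
    mem_partialSimplex (S.indep _) S.univ_notMem hβ (c.sum_β x), ⟨_, by linarith, e3⟩, ?_⟩
  rw [segment_eq_image']
  -- The segment may degenerate to a point, where the quotient of heights is useless.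
  rcases (sub_nonneg.2 (h2.trans h1)).eq_or_lt with h | h
  · have h0 : c.hs x = 0 := by linarith
    refine ⟨0, by simp, ?_⟩
    simpa [h0] using e1
  · refine ⟨c.hs x / (c.hs x - c.he x), ⟨by positivity, by rw [div_le_one h]; linarith⟩, ?_⟩
    simp only
    rw [e3, add_sub_cancel_left, smul_smul, div_mul_cancel₀ _ h.ne', e1]

end Coords

/-- The weak hyperplane condition says that the heights of consecutive swipes above their common
turning set agree. -/
theorem he_eq_hs {S : SwipeSeq m} (hS : S.WeakHyperplane) (i : Fin S.last)
    (c : S.Coords i.castSucc) (c' : S.Coords i.succ) (x : Fin m → ℝ) : c.he x = c'.hs x := by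
  obtain ⟨n, b, hn, hb, hdir⟩ := hS i
  have hv := eq_vertex_of_eq_partialSimplex (S.indep i.castSucc.succ) S.univ_notMem hb
  have hval : ∀ (j : Fin m) w t, ∑ a, w a = 1 →
      ∑ l, n l * coordPoint (S.vertex i.castSucc.succ) (Pi.single j 1) w t l = b + t * n j := by
    intro j w t hw
    simp only [coordPoint, Pi.add_apply, Finset.sum_apply, Pi.smul_apply, smul_eq_mul, mul_add,
      Finset.sum_add_distrib, Finset.mul_sum]
    rw [Finset.sum_comm]
    congr 1
    · have : ∀ a, ∑ l, n l * (w a * S.vertex i.castSucc.succ a l) = w a * b := fun a => by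
        rw [← hv a, Finset.mul_sum]
        exact Finset.sum_congr rfl fun l _ => by ring
      simp only [this, ← Finset.sum_mul, hw, one_mul]
    · simp [Pi.single_apply, mul_comm]
  have h1 : ∀ x, ∑ l, n l * x l = b + c.he x * n (S.dir i.castSucc) := fun x => by
    rw [← hval _ _ _ (c.sum_β x), c.fin x]
  have h2 : ∑ l, n l * x l = b + c'.hs x * n (S.dir i.succ) := by
    rw [← hval _ _ _ (c'.sum_β x)]
    exact congrArg (fun y : Fin m → ℝ => ∑ l, n l * y l) (c'.start x).symm
  -- Otherwise the form `∑ l, n l * x l` would be constant on the whole space, forcing `n = 0`.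
  have hne : n (S.dir i.castSucc) ≠ 0 := by
    intro h0
    refine hn (funext fun l => ?_)
    have h3 := h1 (Pi.single l 1)
    have h4 := h1 0
    simp only [h0, mul_zero, add_zero, Pi.single_apply, mul_ite, mul_one, Finset.sum_ite_eq',
      Finset.mem_univ, if_true, Pi.zero_apply, Finset.sum_const_zero] at h3 h4
    rw [h3, ← h4]; rfl
  rw [h1, ← hdir] at h2
  exact mul_right_cancel₀ hne (add_left_cancel h2)

/-- The index of a swipe, with the last swipe in place of the swipes beyond it. -/
def clamp (i : ℕ) : Fin (S.last + 1) := ⟨min i S.last, by omega⟩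

theorem clamp_zero : S.clamp 0 = 0 := by ext; simp [clamp]

theorem clamp_of_le {i : ℕ} (hi : i ≤ S.last) : S.clamp i = ⟨i, by omega⟩ := by
  ext; simp [clamp, hi]

theorem clamp_of_ge {i : ℕ} (hi : S.last ≤ i) : S.clamp i = Fin.last _ := by
  ext; simp [clamp, hi]

/-- The height above the `j`-th turning set. -/
def height (c : ∀ i, S.Coords i) : ℕ → (Fin m → ℝ) →ᵃ[ℝ] ℝ
  | 0 => (c 0).hs
  | j + 1 => (c (S.clamp j)).he

theorem height_eq_hs {S : SwipeSeq m} (hS : S.WeakHyperplane) (c : ∀ i, S.Coords i) {j : ℕ}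
    (hj : j ≤ S.last) : S.height c j = (c (S.clamp j)).hs := by
  cases j with
  | zero => rw [height, clamp_zero]
  | succ j =>
    ext x
    rw [height, S.clamp_of_le hj, S.clamp_of_le (by omega)]
    exact he_eq_hs hS ⟨j, hj⟩ (c _) (c _) x

theorem height_eq_of_gt {S : SwipeSeq m} (c : ∀ i, S.Coords i) {j : ℕ} (hj : S.last < j) :
    S.height c j = (c (S.clamp S.last)).he := by
  obtain ⟨j, rfl⟩ := Nat.exists_eq_succ_of_ne_zero (n := j) (by omega)
  rw [height, S.clamp_of_ge (by omega), S.clamp_of_ge le_rfl]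

/-- The track of a sequence of swipes with the weak hyperplane condition. -/
def track {S : SwipeSeq m} (hS : S.WeakHyperplane) (c : ∀ i, S.Coords i) : Track m where
  d := S.d
  last := S.last
  dir i := S.dir (S.clamp i)
  h := S.height c
  β i := (c (S.clamp i)).β
  h_dir i := by
    rcases le_or_gt i S.last with hi | hi
    · rw [height_eq_hs hS c hi, Coords.hs_dir]
    · rw [height_eq_of_gt c hi, S.clamp_of_ge hi.le, ← S.clamp_of_ge le_rfl, Coords.he_dir]
  h_succ_dir i := (c (S.clamp i)).he_dir
  β_dir i a := (c (S.clamp i)).β_dir a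
  β_eq_one i a := (c (S.clamp i)).β_eq_one a
  h_succ_le i x hx := by
    rcases le_or_gt i S.last with hi | hi
    · rw [height_eq_hs hS c hi]; exact (c (S.clamp i)).le x hx
    · rw [height_eq_of_gt c hi, height_eq_of_gt c (hi.trans (Nat.lt_succ_self i))]
  -- Sliding `x` along the old direction by its height reaches the common turning hyperplane, where
  -- old and new barycentric coordinates agree. The old one is unchanged by the slide and the new
  -- one changes linearly with the height.
  β_sub i hi a := by
    rw [S.clamp_of_le hi.le, S.clamp_of_le hi]
    set c' := c ⟨i + 1, by omega⟩
    refine ⟨-(c'.β a).linear (Pi.single (S.dir ⟨i, by omega⟩) 1), fun x => ?_⟩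
    rw [height, S.clamp_of_le hi.le]
    set c₀ := c ⟨i, by omega⟩
    have h1 := c₀.fin x
    rw [← zero_add (c₀.he x), coordPoint_add] at h1
    have h2 := (c'.start_unique _ 0 (c₀.sum_β x)).1 a
    have h3 := AffineMap.map_add_linear (c'.β a) (coordPoint (S.vertex (Fin.succ ⟨i, by omega⟩))
      (Pi.single (S.dir ⟨i, by omega⟩) 1) (fun a => c₀.β a x) 0)
      (c₀.he x • Pi.single (S.dir ⟨i, by omega⟩) 1)
    rw [h1, map_smul, smul_eq_mul] at h3
    have h4 : c'.β a (coordPoint (S.vertex (Fin.succ ⟨i, by omega⟩))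
      (Pi.single (S.dir ⟨i, by omega⟩) 1) (fun a => c₀.β a x) 0) = c₀.β a x := by
      rw [← h2]
      congr 1
      simp only [coordPoint, zero_smul]
      rfl
    rw [h3, h4]; ring
  rkStart a := rk (S.vertex 0 a)
  rkEnd a := rk (S.vertex (Fin.last _) a)
  rk_eq_start x := by
    rw [S.clamp_zero, height]
    conv_lhs => rw [← (c 0).start x, rk_coordPoint]
    rfl
  rk_eq_end x := by
    rw [height, S.clamp_of_ge le_rfl]
    conv_lhs => rw [← (c (Fin.last _)).fin x, rk_coordPoint]
    rfl
  sum_β i x := (c (S.clamp i)).sum_β x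

section Carries

variable {S} (hS : S.WeakHyperplane) (c : ∀ i, S.Coords i)

theorem track_of_mem_swipe {i : Fin (S.last + 1)} {x : Fin m → ℝ} (hx : x ∈ S.swipe i) :
    (∀ a, 0 ≤ (track hS c).β i a x) ∧ 0 ≤ (track hS c).h i x ∧ (track hS c).h (i + 1) x ≤ 0 := by
  have hi : (i : ℕ) ≤ S.last := by omega
  have e : S.clamp i = i := S.clamp_of_le hi
  have h := (c i).of_mem_swipe hx
  refine ⟨fun a => ?_, ?_, ?_⟩
  · change 0 ≤ (c (S.clamp i)).β a x
    rw [e]; exact h.1 a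
  · change 0 ≤ S.height c i x
    rw [height_eq_hs hS c hi, e]; exact h.2.1
  · change (c (S.clamp i)).he x ≤ 0
    rw [e]; exact h.2.2

theorem track_mem_swipe {i : Fin (S.last + 1)} {x : Fin m → ℝ} (hx : (track hS c).Cell i x) :
    x ∈ S.swipe i := by
  have hi : (i : ℕ) ≤ S.last := by omega
  have e : S.clamp i = i := S.clamp_of_le hi
  obtain ⟨h1, h2, h3⟩ := hx
  change ∀ a, 0 < (c (S.clamp i)).β a x at h1
  change 0 < S.height c i x at h2
  change (c (S.clamp i)).he x ≤ 0 at h3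
  rw [height_eq_hs hS c hi] at h2
  rw [e] at h1 h2 h3
  exact (c i).mem_swipe h1 h2.le h3

theorem track_start {i : Fin (S.last + 1)} {x : Fin m → ℝ} (hx : x ∈ S.startSet i) :
    (track hS c).h i x = 0 := by
  have hi : (i : ℕ) ≤ S.last := by omega
  change S.height c i x = 0
  rw [height_eq_hs hS c hi, S.clamp_of_le hi]
  exact (c i).hs_eq_zero hx

theorem track_end {i : Fin (S.last + 1)} {x : Fin m → ℝ} (hx : x ∈ S.endSet i) :
    (track hS c).h (i + 1) x = 0 := by
  have hi : (i : ℕ) ≤ S.last := by omega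
  change (c (S.clamp i)).he x = 0
  rw [S.clamp_of_le hi]
  exact (c i).he_eq_zero hx

/-- Halting at the start is excluded by the positive height in the cell. Halting at the end would
put `x` in all later turning sets, making every later height zero. -/
theorem track_not_halted {i : Fin (S.last + 1)} {x : Fin m → ℝ} (hx : (track hS c).Cell i x)
    (h : ∃ l > (i : ℕ), (track hS c).h l x ≠ 0) : ¬ S.Halted i x := by
  rintro (⟨-, h1⟩ | ⟨h1, h2⟩)
  · exact hx.2.1.ne' (track_start hS c h1)
  · have key : ∀ l, (i : ℕ) ≤ l → l ≤ S.last → (track hS c).h (l + 1) x = 0 := by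
      intro l hl hl'
      rcases hl.eq_or_lt with rfl | hl
      · exact track_end hS c h2
      · exact track_end hS c (i := ⟨l, by omega⟩) (h1 ⟨l, by omega⟩ hl).2
    obtain ⟨l, hl, hne⟩ := h
    refine hne ?_
    rcases le_or_gt l S.last with hl' | hl'
    · obtain ⟨l, rfl⟩ := Nat.exists_eq_succ_of_ne_zero (n := l) (by omega)
      exact key l (by omega) (by omega)
    · have h3 := key S.last (by omega) le_rfl
      change S.height c l x = 0
      rw [height_eq_of_gt c hl']
      exact h3

theorem track_carries {X : Set (Fin m → ℝ)} (hX : S.IsSnake X) : (track hS c).Carries X := by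
  have hlast : (track hS c).last = S.last := rfl
  rcases hX with ⟨hX, rfl⟩ | ⟨hX, rfl⟩
  · refine ⟨fun x hx => ?_, fun i hi x hx _ => ?_, fun i j hij hj x hi hxj _ => ?_⟩
    · obtain ⟨i, hi⟩ := mem_iUnion.1 hx
      exact ⟨i, by omega, track_of_mem_swipe hS c hi⟩
    · exact mem_iUnion.2 ⟨⟨i, by omega⟩, track_mem_swipe hS c hx⟩
    · have h := (hX ⟨i, by omega⟩ ⟨j, by omega⟩ hij x (track_mem_swipe hS c hi)
        (track_mem_swipe hS c hxj)).2.1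
      exact hxj.2.1.ne' (track_start hS c h)
  · refine ⟨fun x hx => ?_, fun i hi x hx hl => ?_, fun i j hij hj x hi hxj hl => ?_⟩
    · obtain ⟨i, hi⟩ := mem_iUnion.1 hx
      exact ⟨i, by omega, track_of_mem_swipe hS c hi.1⟩
    · exact mem_iUnion.2 ⟨⟨i, by omega⟩, track_mem_swipe hS c hx, track_not_halted hS c hx hl⟩
    -- The positive height over turning set `j` itself shows that `x` is not halted in the earlier
    -- swipe.
    · have h := (hX ⟨i, by omega⟩ ⟨j, by omega⟩ hij x
        ⟨track_mem_swipe hS c hi, track_not_halted hS c hi ⟨j, hij, hxj.2.1.ne'⟩⟩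
        ⟨track_mem_swipe hS c hxj, track_not_halted hS c hxj hl⟩).2.1
      exact hxj.2.1.ne' (track_start hS c h)

end Carries

/-! ### The dimension of the turning sets -/

theorem IsSnake.subset_realSet {S : SwipeSeq m} {X : Set (Fin m → ℝ)} (hX : S.IsSnake X) :
    X ⊆ S.realSet := by
  rcases hX with ⟨-, rfl⟩ | ⟨-, rfl⟩
  · exact subset_rfl
  · exact iUnion_mono fun i x hx => hx.1

/-- The turning sets of a full-dimensional snake have codimension one. -/
theorem d_add_one_eq {S : SwipeSeq m} {X : Set (Fin m → ℝ)} (hX : S.IsSnake X)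
    (hint : (interior X).Nonempty) : S.d + 1 = m := by
  have hfin : ∀ j, Module.finrank ℝ (vectorSpan ℝ (range (S.vertex j))) = S.d := fun j =>
    (S.indep j).finrank_vectorSpan (by simp)
  have hle : S.d + 1 ≤ m := by
    have hlt : vectorSpan ℝ (range (S.vertex (Fin.castSucc 0))) < ⊤ :=
      lt_top_iff_ne_top.2 fun h => S.transversal 0 (h ▸ Submodule.mem_top)
    have := Submodule.finrank_lt hlt.ne
    rw [hfin] at this
    simpa using this
  by_contra hne
  have hlt : S.d + 1 < m := lt_of_le_of_ne hle hne
  -- Each swipe lies in an affine subspace of dimension at most `d + 1`. If `d + 1 < m`, finitely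
  -- many of these have measure zero and cannot cover an open set.
  let W : Fin (S.last + 1) → Submodule ℝ (Fin m → ℝ) := fun i =>
    vectorSpan ℝ (range (S.vertex i.castSucc)) ⊔ ℝ ∙ (Pi.single (S.dir i) (1 : ℝ) : Fin m → ℝ)
  have hW : ∀ i, W i ≠ ⊤ := by
    intro i h
    have h1 := Submodule.finrank_add_le_finrank_add_finrank
      (vectorSpan ℝ (range (S.vertex i.castSucc))) (ℝ ∙ (Pi.single (S.dir i) (1 : ℝ) : Fin m → ℝ))
    rw [show vectorSpan ℝ (range (S.vertex i.castSucc)) ⊔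
      ℝ ∙ (Pi.single (S.dir i) (1 : ℝ) : Fin m → ℝ) = ⊤ from h, finrank_top, hfin] at h1
    have h2 := finrank_span_singleton (K := ℝ)
      (show (Pi.single (S.dir i) (1 : ℝ) : Fin m → ℝ) ≠ 0 by simp)
    simp only [Module.finrank_fin_fun] at h1
    omega
  let H : Fin (S.last + 1) → AffineSubspace ℝ (Fin m → ℝ) := fun i =>
    AffineSubspace.mk' (S.vertex i.castSucc 0) (W i)
  have hH : ∀ i, H i ≠ ⊤ := by
    intro i h
    refine hW i ?_
    have := congrArg AffineSubspace.direction h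
    rwa [AffineSubspace.direction_mk', AffineSubspace.direction_top] at this
  have hsub : ∀ i, S.swipe i ⊆ H i := by
    rintro i x ⟨y, hy, y', hy', ⟨t, ht, rfl⟩, hxy⟩
    have hy1 : y ∈ H i := by
      have h1 : y ∈ affineSpan ℝ (range (S.vertex i.castSucc)) :=
        convexHull_subset_affineSpan _ hy.1
      rw [AffineSubspace.mem_mk']
      refine Submodule.mem_sup_left ?_
      rw [← direction_affineSpan]
      exact AffineSubspace.vsub_mem_direction h1 (mem_affineSpan ℝ (mem_range_self 0))
    have hy2 : y + t • Pi.single (S.dir i) (1 : ℝ) ∈ H i := by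
      rw [add_comm]
      refine AffineSubspace.vadd_mem_of_mem_direction ?_ hy1
      rw [AffineSubspace.direction_mk']
      exact Submodule.mem_sup_right (Submodule.smul_mem _ _ (Submodule.mem_span_singleton_self _))
    exact (H i).convex.segment_subset hy1 hy2 hxy
  have h0 : MeasureTheory.volume X = 0 := by
    refine MeasureTheory.measure_mono_null (hX.subset_realSet.trans (iUnion_mono hsub)) ?_
    exact MeasureTheory.measure_iUnion_null fun i =>
      MeasureTheory.Measure.addHaar_affineSubspace _ _ (hH i)
  exact (isOpen_interior.measure_pos MeasureTheory.volume hint).ne'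
    (MeasureTheory.measure_mono_null interior_subset h0)

end SwipeSeq

/-! ### Assembling the chains of all snakes -/

/-- Few exceptional points can be deleted at the cost of a factor `O(1/k)`. -/
theorem Negligible.exists_ncard_le {m : ℕ} {P : Set (Fin m → ℝ)} (hP : IsFullDimPolytope P)
    {E : ℕ → Set (Fin m → ℝ)} (hE : Negligible P E) :
    ∃ (K₀ : ℕ) (C : ℝ), ∀ k ≥ K₀, 1 ≤ k →
      ((E k ∩ latticePoints P k).ncard : ℝ) ≤ C / k * (latticePoints P k).ncard := by
  obtain ⟨C, hC⟩ := hE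
  obtain ⟨K₀, c, hc, hlow⟩ := exists_le_ncard_latticePoints hP
  refine ⟨K₀, |C| / c, fun k hk hk1 => ?_⟩
  have hk0 : (0 : ℝ) < k := by exact_mod_cast hk1
  have h1 := hC k hk1
  have h2 := hlow k hk
  have h3 : C * (k : ℝ) ^ m ≤ |C| * (k : ℝ) ^ m := by gcongr; exact le_abs_self C
  have h4 : |C| * (k : ℝ) ^ m ≤ |C| / c * (latticePoints P k).ncard := by
    calc |C| * (k : ℝ) ^ m = |C| / c * (c * (k : ℝ) ^ m) := by field_simp
      _ ≤ _ := by gcongr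
  rw [div_mul_eq_mul_div, le_div_iff₀ hk0]
  linarith

theorem theorem3p6 {m : ℕ} (P : Set (Fin m → ℝ)) (hP : IsFullDimPolytope P)
    (𝒟 : AsymptoticGSCD P) (h𝒟 : 𝒟.WeakHyperplane) :
    ∃ C : ℝ, ∀ k : ℕ, 1 ≤ k →
      ∃ D : Set (Fin m → ℝ), D ⊆ latticePoints P k ∧
        (D.ncard : ℝ) ≤ C / k * (latticePoints P k).ncard ∧
        DecomposesIntoSymmetricChains (latticePoints P k) k (latticePoints P k \ D) := by
  obtain ⟨B, hB⟩ := hP.bounded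
  have hsnake : ∀ s, ∃ (K₀ : ℕ) (𝒞 : ℕ → Set (Set (Fin m → ℝ))),
      (∀ k ≥ K₀, (∀ c ∈ 𝒞 k, IsSymmetricChain (latticePoints P k) k c ∧ c ⊆ 𝒟.snake s) ∧
        (𝒞 k).PairwiseDisjoint id) ∧
      Negligible P (fun k => {x | K₀ ≤ k ∧ x ∈ 𝒟.snake s ∧ x ∉ ⋃₀ 𝒞 k}) := by
    intro s
    have hd := SwipeSeq.d_add_one_eq (𝒟.isSnake s) (𝒟.fullDim s)
    have c := fun i => ((𝒟.seq s).nonempty_coords hd i).some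
    exact (SwipeSeq.track (h𝒟 s) c).exists_chains hP (𝒟.subset s)
      (SwipeSeq.track_carries (h𝒟 s) c (𝒟.isSnake s)) (𝒟.symmetric s)
  choose K 𝒞 hchain hneg using hsnake
  obtain ⟨K₁, C, hC⟩ :=
    ((negligible_of_codim hB 𝒟.codim).union (Negligible.iUnion hneg)).exists_ncard_le hP
  set K₀ : ℕ := K₁ + ∑ s, K s with hK₀
  have hKle : ∀ s, K s ≤ K₀ := fun s =>
    (Finset.single_le_sum (f := K) (fun _ _ => Nat.zero_le _) (Finset.mem_univ s)).trans
      (Nat.le_add_left _ _)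
  -- The summand `K₀` makes the bound at least `|P(k)|` when `k < K₀`, so that everything may be
  -- deleted.
  refine ⟨|C| + K₀, fun k hk => ?_⟩
  have hk0 : (0 : ℝ) < k := by exact_mod_cast hk
  rcases lt_or_ge k K₀ with hlt | hge
  · -- for small `k` everything is deleted
    refine ⟨latticePoints P k, subset_rfl, ?_, ∅, by simp, by simp, by simp⟩
    refine le_mul_of_one_le_left (Nat.cast_nonneg _) ?_
    rw [one_le_div hk0]
    have : (k : ℝ) ≤ K₀ := by exact_mod_cast hlt.le
    linarith [abs_nonneg C]
  · have hsub : ⋃₀ (⋃ s, 𝒞 s k) ⊆ latticePoints P k := by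
      refine sUnion_subset fun c hc => ?_
      obtain ⟨s, hs⟩ := mem_iUnion.1 hc
      obtain ⟨n, x, hx, -, -, rfl⟩ := ((hchain s k ((hKle s).trans hge)).1 c hs).1
      exact range_subset_iff.2 hx
    refine ⟨latticePoints P k \ ⋃₀ (⋃ s, 𝒞 s k), sdiff_subset, ?_, ⋃ s, 𝒞 s k, ?_, ?_, ?_⟩
    · have h1 : latticePoints P k \ ⋃₀ (⋃ s, 𝒞 s k) ⊆ ((P \ ⋃ s, 𝒟.snake s) ∪
          ⋃ s, {x | K s ≤ k ∧ x ∈ 𝒟.snake s ∧ x ∉ ⋃₀ 𝒞 s k}) ∩ latticePoints P k := by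
        rintro x ⟨hx, hx'⟩
        refine ⟨?_, hx⟩
        by_cases h : x ∈ ⋃ s, 𝒟.snake s
        · obtain ⟨s, hs⟩ := mem_iUnion.1 h
          refine Or.inr (mem_iUnion.2 ⟨s, (hKle s).trans hge, hs, fun hc => hx' ?_⟩)
          exact sUnion_mono (subset_iUnion (fun s => 𝒞 s k) s) hc
        · exact Or.inl ⟨hx.1, h⟩
      have h2 := ncard_le_ncard h1 ((finite_latticePoints hB hk).subset inter_subset_right)
      calc _ ≤ C / k * ((latticePoints P k).ncard : ℝ) :=
            (Nat.cast_le.2 h2).trans (hC k (by omega) hk)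
        _ ≤ _ := by
          gcongr
          have : (0 : ℝ) ≤ K₀ := Nat.cast_nonneg _
          linarith [le_abs_self C]
    · intro c hc
      obtain ⟨s, hs⟩ := mem_iUnion.1 hc
      exact ((hchain s k ((hKle s).trans hge)).1 c hs).1
    · intro c hc c' hc' hne
      obtain ⟨s, hs⟩ := mem_iUnion.1 hc
      obtain ⟨t, ht⟩ := mem_iUnion.1 hc'
      by_cases hst : s = t
      · subst hst
        exact (hchain s k ((hKle s).trans hge)).2 hs ht hne
      · exact (𝒟.disjoint s t hst).mono ((hchain s k ((hKle s).trans hge)).1 c hs).2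
          ((hchain t k ((hKle t).trans hge)).1 c' ht).2
    · rw [sdiff_sdiff_right_self]
      exact (inter_eq_right.2 hsub).symm
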